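/- Let $I\subseteq\mathbb R$ be a non-empty open interval and let $X:I\to\mathbb R^2$ be a strictly locally convex plane curve. That is: $X$ is of class $C^3$ and regular ($X'\neq 0$ on $I$); $X$ is locally convex, i.e. every $s\in I$ lies in an open subinterval $I_0\subseteq I$ such that for each $u\in I_0$ the set $X(I_0)$ lies in one of the two closed half-planes bounded by the tangent line at $X(u)$; and the curvature $\kappa=\langle X'',N\rangle/\|X'\|^2$ of $X$ is positive on $I$, where $N$ is the unit normal pointing to the convex side (for each $s\in I$, $\langle X(u)-X(s),N(s)\rangle\ge 0$ for all $u$ near $s$). For a point $P=X(s)$ of the curve and sufficiently small $h>0$, let $\ell$ be the line through $P+hN(P)$ parallel to the tangent line at $P$; let $A$ and $B$ be the two points in which $\ell$ meets the curve near $P$, i.e. $A=X(a)$ and $B=X(b)$ where $a$ is the last parameter before $s$ and $b$ is the first parameter after $s$ at which the curve meets $\ell$; let $Q$ be the intersection point of the tangent lines of $X$ at $A$ and $B$. Let $j_P(h)$ be the distance from the centroid of the triangle $QAB$ to the line $\ell$. Then the following three conditions are equivalent. 1. There are real-valued functions $\lambda$ and $\mu$ of the point $P$ of the curve such that, for every $P$,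 $j_P(h)=\lambda(P)\,h^{\mu(P)}$ for all sufficiently small $h>0$. 2. For every point $P$ of the curve, $j_P(h)=\frac23 h$ for all sufficiently small $h>0$. 3. $X$ is an open part of a parabola, i.e. $X(I)$ is a relatively open subset of a parabola. In 1 and 2, points of the curve are points with their parameter $s\in I$, and how small $h$ has to be may depend on the point. -/

import Mathlib

open Filter Topology
open scoped RealInnerProductSpace

noncomputable section

namespace PlaneCurve

/-- The Euclidean plane. -/
abbrev Plane : Type := EuclideanSpace ℝ (Fin 2)

/-- The tangent line of the curve `X` at the parameter `s`. -/
def tangentLine (X : ℝ → Plane) (s : ℝ) : AffineSubspace ℝ Plane :=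
  AffineSubspace.mk' (X s) (Submodule.span ℝ {deriv X s})

/-- The curve `X` restricted to `I` is convex: for every `s ∈ I` the trace `X(I)` lies in one of
the two closed half-planes bounded by the tangent line at `X s`. -/
def IsConvexCurve (I : Set ℝ) (X : ℝ → Plane) : Prop :=
  ∀ s ∈ I, ∃ n : Plane, n ≠ 0 ∧ ⟪n, deriv X s⟫ = 0 ∧ ∀ u ∈ I, 0 ≤ ⟪n, X u - X s⟫

/-- Every `s ∈ I` has an open subinterval `I₀ ⊆ I` around it on which `X` is convex. -/
def IsLocallyConvexCurve (I : Set ℝ) (X : ℝ → Plane) : Prop :=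
  ∀ s ∈ I, ∃ I₀ : Set ℝ, I₀ ⊆ I ∧ IsOpen I₀ ∧ I₀.OrdConnected ∧ s ∈ I₀ ∧ IsConvexCurve I₀ X

/-- The curvature of a regular curve `X` with respect to the unit normal `N`. In an arc-length
parametrization `‖X'‖ = 1` and this is `⟨X'', N⟩`; the quotient is invariant under regular
changes of the parameter. -/
def curvature (X N : ℝ → Plane) (s : ℝ) : ℝ :=
  ⟪deriv (deriv X) s, N s⟫ / ‖deriv X s‖ ^ 2

/-- `X : I → ℝ²` is a strictly locally convex curve, and `N s` is, for `s ∈ I`, its unit normal at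
`X s` that points to the convex side. -/
structure IsStrictlyLocallyConvex (I : Set ℝ) (X N : ℝ → Plane) : Prop where
  isOpen : IsOpen I
  ordConnected : I.OrdConnected
  nonempty : I.Nonempty
  contDiffOn : ContDiffOn ℝ 3 X I
  regular : ∀ s ∈ I, deriv X s ≠ 0
  locallyConvex : IsLocallyConvexCurve I X
  norm_normal : ∀ s ∈ I, ‖N s‖ = 1
  inner_normal : ∀ s ∈ I, ⟪deriv X s, N s⟫ = 0
  convexSide : ∀ s ∈ I, ∀ᶠ u in 𝓝 s, 0 ≤ ⟪X u - X s, N s⟫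
  curvature_pos : ∀ s ∈ I, 0 < curvature X N s

/-- The line `ℓ` through `P + h N(P)` parallel to the tangent line at `P = X s`. -/
def chordLine (X N : ℝ → Plane) (s h : ℝ) : AffineSubspace ℝ Plane :=
  AffineSubspace.mk' (X s + h • N s) (Submodule.span ℝ {deriv X s})

/-- The parameter of `A`: the last parameter before `s` at which the curve meets `ℓ`. -/
def paramA (I : Set ℝ) (X N : ℝ → Plane) (s h : ℝ) : ℝ :=
  sSup {u | u ∈ I ∧ u < s ∧ X u ∈ chordLine X N s h}

/-- The parameter of `B`: the first parameter after `s` at which the curve meets `ℓ`. -/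
def paramB (I : Set ℝ) (X N : ℝ → Plane) (s h : ℝ) : ℝ :=
  sInf {u | u ∈ I ∧ s < u ∧ X u ∈ chordLine X N s h}

/-- The endpoint `A` of the chord cut out by `ℓ` near `P = X s`. -/
def pointA (I : Set ℝ) (X N : ℝ → Plane) (s h : ℝ) : Plane := X (paramA I X N s h)

/-- The endpoint `B` of the chord cut out by `ℓ` near `P = X s`. -/
def pointB (I : Set ℝ) (X N : ℝ → Plane) (s h : ℝ) : Plane := X (paramB I X N s h)

/-- The intersection point `Q` of the tangent lines at `A` and `B` (these lines meet in exactly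
one point for small `h > 0`). -/
def pointQ (I : Set ℝ) (X N : ℝ → Plane) (s h : ℝ) : Plane :=
  Classical.epsilon fun q : Plane =>
    q ∈ tangentLine X (paramA I X N s h) ∧ q ∈ tangentLine X (paramB I X N s h)

/-- The centroid `J` of the triangle `QAB`. -/
def centroidJ (I : Set ℝ) (X N : ℝ → Plane) (s h : ℝ) : Plane :=
  (1 / 3 : ℝ) • (pointQ I X N s h + pointA I X N s h + pointB I X N s h)

/-- `j_P(h)` for `P = X s`: the distance from the centroid `J` of `QAB` to the line `ℓ`. -/
def distJ (I : Set ℝ) (X N : ℝ → Plane) (s h : ℝ) : ℝ :=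
  Metric.infDist (centroidJ I X N s h) (chordLine X N s h : Set Plane)

/-- A parabola: the points equidistant from a focus `F` and a directrix
`{x | ⟨n, x⟩ = c}`, `‖n‖ = 1`, that does not contain `F`. -/
def IsParabola (C : Set Plane) : Prop :=
  ∃ (F n : Plane) (c : ℝ), ‖n‖ = 1 ∧ ⟪n, F⟫ ≠ c ∧ C = {x | dist x F = |⟪n, x⟫ - c|}

/-- The trace `X(I)` is a relatively open subset of a parabola. -/
def IsOpenPartOfParabola (I : Set ℝ) (X : ℝ → Plane) : Prop :=
  ∃ C : Set Plane, IsParabola C ∧ ∃ U : Set Plane, IsOpen U ∧ X '' I = C ∩ U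

end PlaneCurve

end

/-!
Near `P = X s` let `ρ` be the parameter for which `X (ρ θ)` has height `θ²` above the tangent line
at `P`, and let `L θ` be the length of the chord with endpoints `X (ρ (-θ))` and `X (ρ θ)`. The
tangent lines at these endpoints meet at height `θ² - 2 θ L / L'`, so `j_P(θ²) = (2/3) θ L / L'`.
This is `(2/3) θ²` up to a factor that tends to `1`, which leaves no other power law; and
`j_P(h) = (2/3) h` says that `L` is linear in `θ`, that is, that the chords parallel to the tangent
line at `P` are as long as those of a parabola with the same curvature at `P`. On a parabola the
height above a tangent line is the square of an affine parameter, so there `L` is indeed linear.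

Conversely, write the curve locally as a graph `y = f(t)` with `f'' = ψ⁻³`. If `ψ²` were not
convex, a quadratic function `g` with negative leading coefficient would touch it from above at
some `p`. The solution of `y'' = g^(-3/2)` that is tangent to the graph at `p` is an ellipse. The
graph lies inside it, so its chords are at most as long as those of the ellipse, which are too short
for a parabola. So `ψ²` is convex, and likewise concave, hence affine. Its derivative is twice a
coordinate of the affine normal, so the affine normal is constant. Then `X` is a quadratic function
of affine arc length, which traces out an open part of a parabola.
-/

noncomputable section

namespace PlaneCurve

open scoped EuclideanSpace

/-! ### Functions of one real variable -/

theorem exists_contDiffAt_localInverse {n : WithTop ℕ∞} {f : ℝ → ℝ} {s : ℝ}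
    (hf : ContDiffAt ℝ n f s) (hn : n ≠ 0) (h' : deriv f s ≠ 0) :
    ∃ g : ℝ → ℝ, ContDiffAt ℝ n g (f s) ∧ g (f s) = s ∧ ∀ᶠ y in 𝓝 (f s),
      f (g y) = y ∧ (∀ᶠ u in 𝓝 (g y), g (f u) = u) ∧ HasDerivAt g (deriv f (g y))⁻¹ y := by
  have hs : HasFDerivAt f
      (ContinuousLinearEquiv.unitsEquivAut ℝ (Units.mk0 _ h') : ℝ →L[ℝ] ℝ) s :=
    (hf.differentiableAt hn).hasDerivAt.hasFDerivAt_equiv h'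
  have hg : ContDiffAt ℝ n (hf.localInverse hs hn) (f s) := hf.to_localInverse hs hn
  have hgs : hf.localInverse hs hn (f s) = s := hf.localInverse_apply_image hs hn
  have hright : ∀ᶠ y in 𝓝 (f s), f (hf.localInverse hs hn y) = y :=
    (hf.hasStrictFDerivAt' hs hn).eventually_right_inverse
  have hleft : ∀ᶠ u in 𝓝 s, hf.localInverse hs hn (f u) = u :=
    (hf.hasStrictFDerivAt' hs hn).eventually_left_inverse
  have hg1 : ∀ᶠ y in 𝓝 (f s), ContDiffAt ℝ 1 (hf.localInverse hs hn) y :=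
    (hg.of_le (ENat.one_le_iff_ne_zero_withTop.2 hn)).eventually (by norm_num)
  have hf1 : ∀ᶠ u in 𝓝 s, ContDiffAt ℝ 1 f u ∧ deriv f u ≠ 0 := by
    have h1 := hf.of_le (ENat.one_le_iff_ne_zero_withTop.2 hn)
    exact (h1.eventually (by norm_num)).and
      ((h1.derivWithin (m := 0) (by norm_num)).continuousAt.eventually_ne h')
  have htendsto : Tendsto (hf.localInverse hs hn) (𝓝 (f s)) (𝓝 s) := by
    simpa only [hgs] using hg.continuousAt.tendsto
  refine ⟨hf.localInverse hs hn, hg, hgs, ?_⟩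
  filter_upwards [hg1, htendsto.eventually hf1, hright.eventually_nhds,
    htendsto.eventually hleft.eventually_nhds] with y hgy hfy hy hly
  exact ⟨hy.self_of_nhds, hly, (hfy.1.differentiableAt one_ne_zero).hasDerivAt.of_local_left_inverse
    hgy.continuousAt hfy.2 hy⟩

theorem contDiffAt_one_of_tendsto_deriv {f : ℝ → ℝ} {s c : ℝ}
    (hf : ∀ᶠ u in 𝓝[≠] s, ContDiffAt ℝ 1 f u) (hs : HasDerivAt f c s)
    (hc : Tendsto (deriv f) (𝓝[≠] s) (𝓝 c)) : ContDiffAt ℝ 1 f s := by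
  have hnear : ∀ᶠ u in 𝓝 s, DifferentiableAt ℝ f u ∧ ContinuousAt (deriv f) u := by
    rw [← nhdsNE_sup_pure, eventually_sup, eventually_pure]
    refine ⟨hf.mono fun u hu => ⟨hu.differentiableAt one_ne_zero,
      (hu.derivWithin (m := 0) (by norm_num)).continuousAt⟩, hs.differentiableAt, ?_⟩
    rw [← continuousWithinAt_compl_self, ContinuousWithinAt, hs.deriv]
    exact hc
  refine contDiffAt_one_iff.2 ⟨fun u => .toSpanSingleton ℝ (deriv f u), _, hnear,
    fun u hu => ?_, fun u hu => hu.1.hasDerivAt.hasFDerivAt⟩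
  exact ((ContinuousLinearMap.toSpanSingletonCLE (𝕜 := ℝ) (E := ℝ)).continuous.continuousAt.comp
    hu.2).continuousWithinAt

section MorseCoordinate

variable {η : ℝ → ℝ} {s : ℝ}

theorem tendsto_div_sub_sq (hη : ContDiffAt ℝ 2 η s) (h0 : η s = 0) (h1 : deriv η s = 0) :
    Tendsto (fun u => η u / (u - s) ^ 2) (𝓝[≠] s) (𝓝 (deriv (deriv η) s / 2)) := by
  have hdη : ∀ᶠ u in 𝓝 s, DifferentiableAt ℝ η u :=
    (hη.eventually (by norm_num)).mono fun u hu => hu.differentiableAt two_ne_zero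
  have hsq (u : ℝ) : HasDerivAt (fun u => (u - s) ^ 2) (2 * (u - s)) u := by
    simpa using ((hasDerivAt_id u).sub_const s).fun_pow 2
  have hslope : Tendsto (fun u => deriv η u / (2 * (u - s))) (𝓝[≠] s)
      (𝓝 (deriv (deriv η) s / 2)) := by
    have hd := ((hη.derivWithin (m := 1) (by norm_num)).differentiableAt one_ne_zero).hasDerivAt
    refine ((hasDerivAt_iff_tendsto_slope.1 hd).div_const 2).congr fun u => ?_
    rw [slope_def_field, h1, sub_zero, div_div, mul_comm]
  refine HasDerivAt.lhopital_zero_nhdsNE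
    (hdη.filter_mono nhdsWithin_le_nhds |>.mono fun u hu => hu.hasDerivAt)
    (.of_forall hsq) ?_ ?_ ?_ hslope
  · filter_upwards [self_mem_nhdsWithin] with u hu
    exact mul_ne_zero two_ne_zero (sub_ne_zero.2 hu)
  · simpa only [h0] using hη.continuousAt.tendsto.mono_left nhdsWithin_le_nhds
  · simpa using (hsq s).continuousAt.tendsto.mono_left nhdsWithin_le_nhds

/-- The signed square root of a function `η` with a nondegenerate zero minimum at `s`: the factor
`√(η u / (u - s) ^ 2)` is extended to `u = s` by its limit `√(η'' s / 2)`. -/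
noncomputable def morseCoord (η : ℝ → ℝ) (s u : ℝ) : ℝ :=
  (u - s) * √(Function.update (fun u => η u / (u - s) ^ 2) s (deriv (deriv η) s / 2) u)

theorem morseCoord_self : morseCoord η s s = 0 := by
  rw [morseCoord, sub_self, zero_mul]

theorem morseCoord_of_ne {u : ℝ} (hu : u ≠ s) :
    morseCoord η s u = (u - s) * √(η u / (u - s) ^ 2) := by
  rw [morseCoord, Function.update_of_ne hu]

variable (hη : ContDiffAt ℝ 2 η s) (h0 : η s = 0) (h1 : deriv η s = 0)
include hη h0 h1

theorem hasDerivAt_morseCoord : HasDerivAt (morseCoord η s) √(deriv (deriv η) s / 2) s := by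
  rw [hasDerivAt_iff_tendsto_slope]
  refine ((tendsto_div_sub_sq hη h0 h1).sqrt).congr' ?_
  filter_upwards [self_mem_nhdsWithin] with u hu
  rw [slope_def_field, morseCoord_self, sub_zero, morseCoord_of_ne hu,
    mul_div_cancel_left₀ _ (sub_ne_zero.2 hu)]

variable (h2 : 0 < deriv (deriv η) s)
include h2

theorem eventually_div_sub_sq_pos : ∀ᶠ u in 𝓝[≠] s, 0 < η u / (u - s) ^ 2 :=
  (tendsto_div_sub_sq hη h0 h1).eventually (lt_mem_nhds (half_pos h2))

theorem eventually_morseCoord_sq : ∀ᶠ u in 𝓝 s, morseCoord η s u ^ 2 = η u := by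
  rw [← nhdsNE_sup_pure, eventually_sup, eventually_pure]
  refine ⟨?_, by rw [morseCoord_self, h0, zero_pow two_ne_zero]⟩
  filter_upwards [eventually_div_sub_sq_pos hη h0 h1 h2, self_mem_nhdsWithin] with u hpos hu
  rw [morseCoord_of_ne hu, mul_pow, Real.sq_sqrt hpos.le,
    mul_div_cancel₀ _ (pow_ne_zero 2 (sub_ne_zero.2 hu))]

theorem eventually_contDiffAt_morseCoord :
    ∀ᶠ u in 𝓝[≠] s, ContDiffAt ℝ 1 (morseCoord η s) u := by
  have hη' := (hη.eventually (by norm_num)).filter_mono (nhdsWithin_le_nhds (s := {s}ᶜ))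
  filter_upwards [eventually_div_sub_sq_pos hη h0 h1 h2, hη', self_mem_nhdsWithin]
    with u hpos hηu hu
  have hsub : ContDiffAt ℝ 1 (fun u => u - s) u := contDiffAt_id.sub contDiffAt_const
  refine (hsub.mul (((hηu.of_le (by norm_num)).div (hsub.pow 2)
    (pow_ne_zero 2 (sub_ne_zero.2 hu))).sqrt hpos.ne')).congr_of_eventuallyEq ?_
  filter_upwards [isOpen_ne.mem_nhds hu] with v hv using morseCoord_of_ne hv

theorem tendsto_deriv_morseCoord :
    Tendsto (deriv (morseCoord η s)) (𝓝[≠] s) (𝓝 √(deriv (deriv η) s / 2)) := by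
  have hk : √(deriv (deriv η) s / 2) ≠ 0 := (Real.sqrt_pos.2 (half_pos h2)).ne'
  have hslope : Tendsto (fun u => slope (deriv η) s u / (2 * slope (morseCoord η s) s u)) (𝓝[≠] s)
      (𝓝 √(deriv (deriv η) s / 2)) := by
    have hd := ((hη.derivWithin (m := 1) (by norm_num)).differentiableAt one_ne_zero).hasDerivAt
    refine ((hasDerivAt_iff_tendsto_slope.1 hd).div ((hasDerivAt_iff_tendsto_slope.1
      (hasDerivAt_morseCoord hη h0 h1)).const_mul 2)
      (mul_ne_zero two_ne_zero hk)).trans_eq ?_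
    congr 1
    rw [div_eq_iff (mul_ne_zero two_ne_zero hk), mul_left_comm, Real.mul_self_sqrt (half_pos h2).le]
    ring
  refine hslope.congr' ?_
  have hsq := (eventually_morseCoord_sq hη h0 h1 h2).eventually_nhds.filter_mono
    (nhdsWithin_le_nhds (s := {s}ᶜ))
  filter_upwards [eventually_contDiffAt_morseCoord hη h0 h1 h2, hsq, self_mem_nhdsWithin,
    eventually_div_sub_sq_pos hη h0 h1 h2] with u hu hequ hne hpos
  have hus : u - s ≠ 0 := sub_ne_zero.2 hne
  have hτ : morseCoord η s u ≠ 0 := by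
    rw [morseCoord_of_ne hne]
    exact mul_ne_zero hus (Real.sqrt_pos.2 hpos).ne'
  have hderiv : deriv η u = 2 * morseCoord η s u * deriv (morseCoord η s) u := by
    rw [← (EventuallyEq.deriv_eq hequ)]
    simpa using ((hu.differentiableAt one_ne_zero).hasDerivAt.fun_pow 2).deriv
  rw [slope_def_field, slope_def_field, h1, morseCoord_self, hderiv]
  field_simp
  ring

theorem contDiffAt_morseCoord : ContDiffAt ℝ 1 (morseCoord η s) s :=
  contDiffAt_one_of_tendsto_deriv (eventually_contDiffAt_morseCoord hη h0 h1 h2)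
    (hasDerivAt_morseCoord hη h0 h1) (tendsto_deriv_morseCoord hη h0 h1 h2)

theorem exists_morse_param :
    ∃ ρ : ℝ → ℝ, ContDiffAt ℝ 1 ρ 0 ∧ ρ 0 = s ∧ 0 < deriv ρ 0 ∧
      deriv (deriv η) s * deriv ρ 0 ^ 2 = 2 ∧ ∀ᶠ θ in 𝓝 0, η (ρ θ) = θ ^ 2 := by
  have hτ' := (hasDerivAt_morseCoord hη h0 h1).deriv
  have hpos : 0 < deriv (morseCoord η s) s := hτ' ▸ Real.sqrt_pos.2 (half_pos h2)
  obtain ⟨ρ, hρ, hρ0, hinv⟩ := exists_contDiffAt_localInverse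
    (contDiffAt_morseCoord hη h0 h1 h2) one_ne_zero hpos.ne'
  rw [morseCoord_self] at hρ hρ0 hinv
  have hρ' : deriv ρ 0 = (√(deriv (deriv η) s / 2))⁻¹ := by
    rw [hinv.self_of_nhds.2.2.deriv, hρ0, hτ']
  refine ⟨ρ, hρ, hρ0, hρ' ▸ inv_pos.2 (hτ' ▸ hpos), ?_, ?_⟩
  · rw [hρ', inv_pow, Real.sq_sqrt (half_pos h2).le]
    field_simp
  · have hsq := (hρ0 ▸ hρ.continuousAt.tendsto).eventually (eventually_morseCoord_sq hη h0 h1 h2)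
    filter_upwards [hinv, hsq] with θ h h' using by rw [← h', h.1]

end MorseCoordinate

theorem exists_strictMonoOn_Ioo_of_deriv_pos {f : ℝ → ℝ} {a : ℝ} (hf : ContDiffAt ℝ 1 f a)
    (h : 0 < deriv f a) {p : ℝ → Prop} (hp : ∀ᶠ x in 𝓝 a, p x) :
    ∃ ε > 0, StrictMonoOn f (Set.Ioo (a - ε) (a + ε)) ∧
      ∀ x ∈ Set.Ioo (a - ε) (a + ε), p x := by
  have hev := (hf.eventually (by norm_num)).and
    (((hf.derivWithin (m := 0) (by norm_num)).continuousAt.eventually (lt_mem_nhds h)).and hp)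
  obtain ⟨ε, hε, hball⟩ := Metric.eventually_nhds_iff_ball.1 hev
  rw [Real.ball_eq_Ioo] at hball
  refine ⟨ε, hε, strictMonoOn_of_deriv_pos (convex_Ioo _ _)
    (fun x hx => (hball x hx).1.continuousAt.continuousWithinAt) fun x hx => ?_,
    fun x hx => (hball x hx).2.2⟩
  rw [interior_Ioo] at hx
  exact (hball x hx).2.1

theorem tendsto_div_self_of_zero {f : ℝ → ℝ} (hf : DifferentiableAt ℝ f 0) (h0 : f 0 = 0) :
    Tendsto (fun x => f x / x) (𝓝[>] 0) (𝓝 (deriv f 0)) := by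
  refine ((hasDerivAt_iff_tendsto_slope.1 hf.hasDerivAt).mono_left
    (nhdsGT_le_nhdsNE 0)).congr fun x => ?_
  rw [slope_def_field, h0, sub_zero, sub_zero]

theorem eventually_eq_mul_deriv_iff {f : ℝ → ℝ} (hf : ContDiffAt ℝ 1 f 0) (h0 : f 0 = 0) :
    (∀ᶠ x in 𝓝[>] 0, f x = x * deriv f x) ↔ ∀ᶠ x in 𝓝[>] 0, f x = deriv f 0 * x := by
  constructor <;> intro h
  · obtain ⟨ε, hε, hIoo⟩ := (mem_nhdsGT_iff_exists_Ioo_subset' one_pos).1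
      (h.and (nhdsWithin_le_nhds (hf.eventually (by norm_num))))
    have hderiv : ∀ x ∈ Set.Ioo 0 ε, HasDerivAt (fun x => f x / x) 0 x := fun x hx => by
      obtain ⟨hode, hfx⟩ := hIoo hx
      have hd := (hfx.differentiableAt one_ne_zero).hasDerivAt.div (hasDerivAt_id x) hx.1.ne'
      exact hd.congr_deriv (by simp [hode, mul_comm])
    obtain ⟨K, hK⟩ := isOpen_Ioo.exists_is_const_of_deriv_eq_zero isPreconnected_Ioo
      (fun x hx => (hderiv x hx).differentiableAt.differentiableWithinAt)
      fun x hx => (hderiv x hx).deriv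
    have hev : ∀ᶠ x in 𝓝[>] 0, f x / x = K := mem_of_superset (Ioo_mem_nhdsGT hε) hK
    obtain rfl : deriv f 0 = K := tendsto_nhds_unique
      (tendsto_div_self_of_zero (hf.differentiableAt one_ne_zero) h0)
      (tendsto_const_nhds.congr' (hev.mono fun x hx => hx.symm))
    filter_upwards [hev, self_mem_nhdsWithin] with x hx hpos
    rwa [div_eq_iff (ne_of_gt hpos)] at hx
  · filter_upwards [eventually_nhdsWithin_eventually_nhds_iff_of_isOpen isOpen_Ioi |>.2 h,
      h] with x hx hx'
    rw [hx', EventuallyEq.deriv_eq hx, deriv_const_mul_field, deriv_id'', mul_one, mul_comm]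

theorem tendsto_nhdsGT_zero {f : ℝ → ℝ} (hf : Continuous f) (h0 : f 0 = 0)
    (hpos : ∀ x, 0 < x → 0 < f x) : Tendsto f (𝓝[>] 0) (𝓝[>] 0) :=
  tendsto_nhdsWithin_iff.2 ⟨(hf.tendsto' 0 0 h0).mono_left nhdsWithin_le_nhds,
    eventually_nhdsWithin_of_forall hpos⟩

theorem eventually_nhdsGT_zero_iff_sq {p : ℝ → Prop} :
    (∀ᶠ h in 𝓝[>] (0 : ℝ), p h) ↔ ∀ᶠ θ in 𝓝[>] (0 : ℝ), p (θ ^ 2) := by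
  refine ⟨fun h => (tendsto_nhdsGT_zero (continuous_pow 2) (zero_pow two_ne_zero)
    fun x hx => pow_pos hx 2).eventually h, fun h => ?_⟩
  filter_upwards [(tendsto_nhdsGT_zero Real.continuous_sqrt Real.sqrt_zero
    fun x => Real.sqrt_pos.2).eventually h, self_mem_nhdsWithin] with x hx hpos
  rwa [Real.sq_sqrt (le_of_lt hpos)] at hx

theorem eq_of_tendsto_mul_rpow_div {l m r : ℝ} (hr : r ≠ 0)
    (h : Tendsto (fun x : ℝ => l * x ^ m / x) (𝓝[>] 0) (𝓝 r)) : l = r ∧ m = 1 := by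
  have hlim : Tendsto (fun x : ℝ => l * x ^ (m - 1)) (𝓝[>] 0) (𝓝 r) := by
    refine h.congr' ?_
    filter_upwards [self_mem_nhdsWithin] with x hx
    rw [Real.rpow_sub_one (ne_of_gt hx), mul_div_assoc]
  have hdouble : Tendsto (fun x : ℝ => 2 * x) (𝓝[>] 0) (𝓝[>] 0) :=
    tendsto_nhdsGT_zero (continuous_const_mul 2) (mul_zero 2) fun x => mul_pos two_pos
  -- Doubling the argument multiplies `l * x ^ (m - 1)` by `2 ^ (m - 1)` but keeps its limit.
  have hscale : (2 : ℝ) ^ (m - 1) * r = r := by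
    refine tendsto_nhds_unique ((hlim.const_mul _).congr' ?_) (hlim.comp hdouble)
    filter_upwards [self_mem_nhdsWithin] with x hx
    rw [Function.comp_apply, Real.mul_rpow zero_le_two (le_of_lt hx), mul_left_comm]
  have hm : m = 1 := by
    have hlog := congrArg Real.log (mul_eq_right₀ hr |>.1 hscale)
    rw [Real.log_rpow two_pos, Real.log_one, mul_eq_zero, sub_eq_zero] at hlog
    exact hlog.resolve_right (Real.log_pos one_lt_two).ne'
  subst hm
  simp only [sub_self, Real.rpow_zero, mul_one] at hlim
  exact ⟨tendsto_nhds_unique tendsto_const_nhds hlim, rfl⟩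

theorem tendsto_nhdsGT_of_hasDerivAt_of_pos {f : ℝ → ℝ} {f' a : ℝ} (hf : HasDerivAt f f' a)
    (hf' : 0 < f') : Tendsto f (𝓝[>] a) (𝓝[>] f a) := by
  refine tendsto_nhdsWithin_of_tendsto_nhds_of_eventually_within _
    (hf.continuousAt.tendsto.mono_left nhdsWithin_le_nhds) ?_
  have hslope := ((hasDerivAt_iff_tendsto_slope.1 hf).mono_left (nhdsGT_le_nhdsNE a))
  filter_upwards [hslope.eventually_const_lt hf', self_mem_nhdsWithin] with x hx (hax : a < x)
  exact sub_pos.1 (pos_of_mul_pos_right (by rwa [slope_def_field, div_eq_inv_mul] at hx)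
    (inv_nonneg.2 (sub_pos.2 hax).le))

theorem tendsto_nhdsLT_of_hasDerivAt_of_pos {f : ℝ → ℝ} {f' a : ℝ} (hf : HasDerivAt f f' a)
    (hf' : 0 < f') : Tendsto f (𝓝[<] a) (𝓝[<] f a) := by
  have hneg : HasDerivAt (fun x => -f (-x)) f' (-a) :=
    (((neg_neg a).symm ▸ hf).scomp (-a) (hasDerivAt_neg (-a))).fun_neg.congr_deriv (by simp)
  simpa [Function.comp_def] using tendsto_neg_nhdsGT.comp
    ((tendsto_nhdsGT_of_hasDerivAt_of_pos hneg hf').comp tendsto_neg_nhdsLT)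

/-! ### Graphs with parabolic chords -/

section Convexity

open Set

variable {J : Set ℝ} {g : ℝ → ℝ}

/- A function that violates convexity on `[x, y]` exceeds its chord by more than a small multiple
of `(t - x) * (y - t)`, and where the excess is maximal the forbidden parabola touches. -/
theorem convexOn_of_forall_not_eventually_le (hJ : J.OrdConnected)
    (hg : ContinuousOn g J) (h : ∀ p ∈ J, ∀ q ε : ℝ, 0 < ε →
      ¬∀ᶠ t in 𝓝 p, g t ≤ g p + q * (t - p) - ε * (t - p) ^ 2) : ConvexOn ℝ J g := by
  refine LinearOrder.convexOn_of_lt hJ.convex fun x hx y hy hxy a b ha hb hab => ?_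
  by_contra! hlt
  simp only [smul_eq_mul] at hlt
  set z := a * x + b * y with hz
  obtain rfl : a = 1 - b := by linarith
  have hxz : 0 < z - x := by nlinarith
  have hzy : 0 < y - z := by nlinarith
  set k := (g y - g x) / (y - x) with hk
  have hky : k * (y - x) = g y - g x := div_mul_cancel₀ _ (sub_pos.2 hxy).ne'
  have hexcess : 0 < g z - g x - k * (z - x) := by
    have : k * (z - x) = b * (g y - g x) := by rw [← hky, hz]; ring
    linarith
  set ε := (g z - g x - k * (z - x)) / (2 * ((z - x) * (y - z))) with hε
  have hεpos : 0 < ε := by positivity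
  set F : ℝ → ℝ := fun t => g t - g x - k * (t - x) - ε * ((t - x) * (y - t)) with hF
  have hFx : F x = 0 := by simp only [hF]; ring
  have hFy : F y = 0 := by simp only [hF]; linarith
  have hFz : 0 < F z := by
    have : ε * ((z - x) * (y - z)) = (g z - g x - k * (z - x)) / 2 := by
      rw [hε]; field_simp
    simp only [hF, this]
    linarith
  have hFc : ContinuousOn F (Icc x y) := by
    have := hg.mono (hJ.out hx hy)
    fun_prop
  obtain ⟨p, hp, hmax⟩ := isCompact_Icc.exists_isMaxOn ⟨x, left_mem_Icc.2 hxy.le⟩ hFc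
  have hFp : 0 < F p := hFz.trans_le (hmax ⟨by linarith, by linarith⟩)
  have hxp : x < p := hp.1.lt_of_ne (by rintro rfl; exact hFp.ne' hFx)
  have hpy : p < y := hp.2.lt_of_ne (by rintro rfl; exact hFp.ne' hFy)
  refine h p (hJ.out hx hy hp) (k + ε * (x + y - 2 * p)) ε hεpos ?_
  filter_upwards [Icc_mem_nhds hxp hpy] with t ht
  have : F t ≤ F p := hmax ht
  simp only [hF] at this
  linarith

theorem deriv_eq_of_convexOn_of_concaveOn (hconv : ConvexOn ℝ J g) (hconc : ConcaveOn ℝ J g)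
    (hg : ∀ t ∈ J, DifferentiableAt ℝ g t) {t u : ℝ} (ht : t ∈ J) (hu : u ∈ J) :
    deriv g t = deriv g u := by
  have hmono := hconv.monotoneOn_deriv hg
  have hanti := hconc.antitoneOn_deriv hg
  rcases le_total t u with h | h
  · exact (hmono ht hu h).antisymm (hanti ht hu h)
  · exact (hanti hu ht h).antisymm (hmono hu ht h)

theorem eventually_nonneg_of_deriv_deriv_nonneg {p : ℝ} {g' g'' : ℝ → ℝ}
    (hg : ∀ᶠ t in 𝓝 p, HasDerivAt g (g' t) t) (hg' : ∀ᶠ t in 𝓝 p, HasDerivAt g' (g'' t) t)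
    (hg'' : ∀ᶠ t in 𝓝 p, 0 ≤ g'' t) (hp : g p = 0) (hp' : g' p = 0) :
    ∀ᶠ t in 𝓝 p, 0 ≤ g t := by
  obtain ⟨δ, hδ, H⟩ := Metric.eventually_nhds_iff_ball.1 (hg.and (hg'.and hg''))
  rw [Real.ball_eq_Ioo] at H
  have hpδ : p ∈ Ioo (p - δ) (p + δ) := ⟨by linarith, by linarith⟩
  have hmono : MonotoneOn g' (Ioo (p - δ) (p + δ)) := by
    refine monotoneOn_of_deriv_nonneg (convex_Ioo _ _)
      (fun t ht => (H t ht).2.1.continuousAt.continuousWithinAt) ?_ ?_ <;>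
      rw [interior_Ioo] <;> intro t ht
    · exact (H t ht).2.1.differentiableAt.differentiableWithinAt
    · rw [(H t ht).2.1.deriv]
      exact (H t ht).2.2
  have hmin : IsLocalMin g p := by
    refine isLocalMin_of_deriv_Ioo hpδ.1 hpδ.2 hg.self_of_nhds.continuousAt
      (fun t ht => (H t ⟨ht.1, ht.2.trans hpδ.2⟩).1.differentiableAt.differentiableWithinAt)
      (fun t ht => (H t ⟨hpδ.1.trans ht.1, ht.2⟩).1.differentiableAt.differentiableWithinAt)
      (fun t ht => ?_) (fun t ht => ?_)
    · have htδ : t ∈ Ioo (p - δ) (p + δ) := ⟨ht.1, ht.2.trans hpδ.2⟩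
      rw [(H t htδ).1.deriv, ← hp']
      exact hmono htδ hpδ ht.2.le
    · have htδ : t ∈ Ioo (p - δ) (p + δ) := ⟨hpδ.1.trans ht.1, ht.2⟩
      rw [(H t htδ).1.deriv, ← hp']
      exact hmono hpδ htδ ht.1.le
  filter_upwards [hmin] with t ht
  rwa [hp] at ht

end Convexity

section Conic

variable {m q ε p : ℝ}

/-- The square root `S` of `conicRadicand m q ε x` parametrizes the conic
`(q ^ 2 + ε * m ^ 2) * y = m + q * x / m - S`, which touches the `x`-axis at the origin and
satisfies `y'' = S⁻³`. This conic is compared with graphs whose second derivative is `ψ⁻³`. -/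
def conicRadicand (m q ε x : ℝ) : ℝ := m ^ 2 + 2 * q * x - ε * x ^ 2

theorem conicRadicand_zero : conicRadicand m q ε 0 = m ^ 2 := by simp [conicRadicand]

theorem eventually_conicRadicand_sub_pos (hm : m ≠ 0) :
    ∀ᶠ t in 𝓝 p, 0 < conicRadicand m q ε (t - p) := by
  have hc : ContinuousAt (fun t => conicRadicand m q ε (t - p)) p := by
    unfold conicRadicand; fun_prop
  refine hc.eventually_const_lt ?_
  simp only [sub_self, conicRadicand_zero]
  positivity

theorem hasDerivAt_sqrt_conicRadicand {t : ℝ} (ht : 0 < conicRadicand m q ε (t - p)) :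
    HasDerivAt (fun u => √(conicRadicand m q ε (u - p)))
      ((q - ε * (t - p)) / √(conicRadicand m q ε (t - p))) t := by
  have hx : HasDerivAt (fun u => u - p) 1 t := (hasDerivAt_id t).sub_const p
  have hQ : HasDerivAt (fun u => conicRadicand m q ε (u - p)) (2 * (q - ε * (t - p))) t :=
    (((hx.const_mul (2 * q)).const_add (m ^ 2)).sub ((hx.fun_pow 2).const_mul ε)).congr_deriv
      (by push_cast; ring)
  exact (hQ.sqrt ht.ne').congr_deriv (mul_div_mul_left _ _ two_ne_zero)

theorem hasDerivAt_div_sqrt_conicRadicand {t : ℝ} (ht : 0 < conicRadicand m q ε (t - p)) :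
    HasDerivAt (fun u => (q - ε * (u - p)) / √(conicRadicand m q ε (u - p)))
      (-(q ^ 2 + ε * m ^ 2) / √(conicRadicand m q ε (t - p)) ^ 3) t := by
  have hS : √(conicRadicand m q ε (t - p)) ≠ 0 := (Real.sqrt_pos.2 ht).ne'
  have hSsq : √(conicRadicand m q ε (t - p)) ^ 2 = m ^ 2 + 2 * q * (t - p) - ε * (t - p) ^ 2 :=
    Real.sq_sqrt ht.le
  have hx : HasDerivAt (fun u => u - p) 1 t := (hasDerivAt_id t).sub_const p
  refine (((hx.const_mul ε).const_sub q).div (hasDerivAt_sqrt_conicRadicand ht) hS).congr_deriv ?_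
  rw [div_eq_div_iff (by positivity) (by positivity)]
  field_simp
  linear_combination (-ε) * hSsq

variable {g g' ψ : ℝ → ℝ}

theorem eventually_conic_comparison (hg : ∀ᶠ t in 𝓝 p, HasDerivAt g (g' t) t)
    (hg' : ∀ᶠ t in 𝓝 p, HasDerivAt g' (ψ t ^ 3)⁻¹ t) (hp : g p = 0) (hp' : g' p = 0)
    (hψ : ∀ᶠ t in 𝓝 p, 0 < ψ t)
    (htouch : ∀ᶠ t in 𝓝 p, 0 ≤ ε * (conicRadicand (ψ p) q ε (t - p) - ψ t ^ 2)) :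
    ∀ᶠ t in 𝓝 p, 0 ≤ ε * (q ^ 2 + ε * ψ p ^ 2) * ((q ^ 2 + ε * ψ p ^ 2) * g t -
      (ψ p + q * (t - p) / ψ p - √(conicRadicand (ψ p) q ε (t - p)))) := by
  have hm : 0 < ψ p := hψ.self_of_nhds
  generalize ψ p = m at htouch hm ⊢
  set D := q ^ 2 + ε * m ^ 2 with hD
  set S : ℝ → ℝ := fun t => √(conicRadicand m q ε (t - p)) with hS
  have hpos := eventually_conicRadicand_sub_pos (q := q) (ε := ε) (p := p) hm.ne'
  have hSp : S p = m := by simp [hS, conicRadicand_zero, Real.sqrt_sq hm.le]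
  refine eventually_nonneg_of_deriv_deriv_nonneg
    (g' := fun t => ε * D * (D * g' t - (q / m - (q - ε * (t - p)) / S t)))
    (g'' := fun t => ε * D * (D * (ψ t ^ 3)⁻¹ - D / S t ^ 3)) ?_ ?_ ?_ ?_ ?_
  · filter_upwards [hg, hpos] with t hgt ht
    have hx : HasDerivAt (fun u => m + q * (u - p) / m) (q / m) t :=
      (((((hasDerivAt_id t).sub_const p).const_mul q).div_const m).const_add m).congr_deriv
        (by rw [mul_one])
    exact ((hgt.const_mul D).sub (hx.sub (hasDerivAt_sqrt_conicRadicand ht))).const_mul (ε * D)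
  · filter_upwards [hg', hpos] with t hgt ht
    refine (((hgt.const_mul D).sub ((hasDerivAt_div_sqrt_conicRadicand ht).const_sub
      (q / m))).const_mul (ε * D)).congr_deriv ?_
    simp only [hS, hD]
    ring
  · filter_upwards [htouch, hpos, hψ] with t htt ht hψt
    have hSt : 0 < S t := Real.sqrt_pos.2 ht
    rw [← Real.sq_sqrt ht.le] at htt
    have hle : 0 ≤ ε * (S t - ψ t) := by
      refine nonneg_of_mul_nonneg_left (b := S t + ψ t) ?_ (by positivity)
      exact htt.trans_eq (by ring)
    have hfactor : ε * D * (D * (ψ t ^ 3)⁻¹ - D / S t ^ 3) =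
        D ^ 2 * (ε * (S t - ψ t)) * (S t ^ 2 + S t * ψ t + ψ t ^ 2) / (ψ t ^ 3 * S t ^ 3) := by
      field_simp
      ring
    rw [hfactor]
    positivity
  · simp [hp, conicRadicand_zero, Real.sqrt_sq hm.le]
  · simp [hp', hSp]

/- With `m = ψ p`, `x = t - p`, `y = g t` and `D = q² + ε m²`, the factor of `ε` multiplied by `D`
is `m² (R² - S²)`, where `S` is the radical of the conic and `R = m + q x / m - D y`. So its sign
tells on which side of the conic the point `(x, y)` lies. -/
theorem eventually_conic_sign (hg : ∀ᶠ t in 𝓝 p, HasDerivAt g (g' t) t)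
    (hg' : ∀ᶠ t in 𝓝 p, HasDerivAt g' (ψ t ^ 3)⁻¹ t) (hp : g p = 0) (hp' : g' p = 0)
    (hψ : ∀ᶠ t in 𝓝 p, 0 < ψ t) (hD : q ^ 2 + ε * ψ p ^ 2 ≠ 0)
    (htouch : ∀ᶠ t in 𝓝 p, 0 ≤ ε * (conicRadicand (ψ p) q ε (t - p) - ψ t ^ 2)) :
    ∀ᶠ t in 𝓝 p, ε * ((t - p - q * ψ p * g t) ^ 2 -
      (2 * ψ p ^ 3 * g t - ε * ψ p ^ 4 * g t ^ 2)) ≤ 0 := by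
  have hm : 0 < ψ p := hψ.self_of_nhds
  have hcmp := eventually_conic_comparison hg hg' hp hp' hψ htouch
  generalize ψ p = m at htouch hm hD hcmp ⊢
  have hgc : ContinuousAt g p := hg.self_of_nhds.continuousAt
  have hR : ∀ᶠ t in 𝓝 p, 0 < m + q * (t - p) / m - (q ^ 2 + ε * m ^ 2) * g t := by
    have hc : ContinuousAt (fun t => m + q * (t - p) / m - (q ^ 2 + ε * m ^ 2) * g t) p := by
      fun_prop
    refine hc.eventually_const_lt ?_
    simpa [hp] using hm
  filter_upwards [hcmp, hR, eventually_conicRadicand_sub_pos hm.ne'] with t hcmp hR hpos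
  set D := q ^ 2 + ε * m ^ 2 with hDdef
  set S := √(conicRadicand m q ε (t - p))
  set R := m + q * (t - p) / m - D * g t with hRdef
  have hSsq : S ^ 2 = m ^ 2 + 2 * q * (t - p) - ε * (t - p) ^ 2 := Real.sq_sqrt hpos.le
  have hnonneg : 0 ≤ ε * D * (S ^ 2 - R ^ 2) := by
    have hle : 0 ≤ ε * D * (S - R) := hcmp.trans_eq (by rw [hRdef]; ring)
    have hSR : 0 ≤ S + R := add_nonneg (Real.sqrt_nonneg _) hR.le
    exact (mul_nonneg hle hSR).trans_eq (by ring)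
  have hfactor : ε * D * (S ^ 2 - R ^ 2) = -(D ^ 2 / m ^ 2) *
      (ε * ((t - p - q * m * g t) ^ 2 - (2 * m ^ 3 * g t - ε * m ^ 4 * g t ^ 2))) := by
    rw [hSsq, hRdef]
    field_simp
    rw [hDdef]
    ring
  have hcoef : 0 < D ^ 2 / m ^ 2 := by positivity
  rw [hfactor] at hnonneg
  nlinarith

end Conic

section ParabolicChords

variable {q ε : ℝ}

theorem sub_sq_le_of_sq_le {a b c E : ℝ} (ha : (a - c) ^ 2 ≤ E) (hb : (b - c) ^ 2 ≤ E) :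
    (b - a) ^ 2 ≤ 4 * E := by
  linarith [sq_nonneg ((a - c) + (b - c))]

theorem le_sub_sq_of_le_sq {a b c E : ℝ} (ha₀ : a < 0) (hb₀ : 0 < b) (hc : c ^ 2 < E)
    (ha : E ≤ (a - c) ^ 2) (hb : E ≤ (b - c) ^ 2) : 4 * E ≤ (b - a) ^ 2 := by
  have hac : 0 < c - a := by nlinarith
  have hbc : 0 < b - c := by nlinarith
  rcases le_total (c - a) (b - c) with h | h <;> nlinarith

theorem sub_sq_ne_of_conic_sign {m H a b : ℝ} (hm : 0 < m) (hH : 0 < H) (hε : ε ≠ 0)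
    (ha₀ : a < 0) (hb₀ : 0 < b) (hsmall : (q ^ 2 + ε * m ^ 2) * H < 2 * m)
    (ha : ε * ((a - q * m * H) ^ 2 - (2 * m ^ 3 * H - ε * m ^ 4 * H ^ 2)) ≤ 0)
    (hb : ε * ((b - q * m * H) ^ 2 - (2 * m ^ 3 * H - ε * m ^ 4 * H ^ 2)) ≤ 0) :
    (b - a) ^ 2 ≠ 8 * m ^ 3 * H := by
  have hmH : 0 < m ^ 4 * H ^ 2 := by positivity
  rcases hε.lt_or_gt with hneg | hpos
  · have ha' := sub_nonneg.1 (nonneg_of_mul_nonpos_right ha hneg)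
    have hb' := sub_nonneg.1 (nonneg_of_mul_nonpos_right hb hneg)
    have hcenter : (q * m * H) ^ 2 < 2 * m ^ 3 * H - ε * m ^ 4 * H ^ 2 := by
      have : m ^ 2 * H * ((q ^ 2 + ε * m ^ 2) * H) < m ^ 2 * H * (2 * m) :=
        mul_lt_mul_of_pos_left hsmall (by positivity)
      linarith
    have := le_sub_sq_of_le_sq ha₀ hb₀ hcenter ha' hb'
    have := mul_neg_of_neg_of_pos hneg hmH
    intro h
    linarith
  · have ha' := sub_nonpos.1 (nonpos_of_mul_nonpos_right ha hpos)
    have hb' := sub_nonpos.1 (nonpos_of_mul_nonpos_right hb hpos)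
    have := sub_sq_le_of_sq_le ha' hb'
    have := mul_pos hpos hmH
    intro h
    linarith

/-- The height of the graph of `f` at `t` over the line of slope `r p` through its point at `p`. -/
def tangentGap (f r : ℝ → ℝ) (p t : ℝ) : ℝ := f t - f p - r p * (t - p)

/-- Arbitrarily close to its point at `p`, the graph of `f` has chords that are parallel to the
line of slope `r p` and have the length such a chord has in a parabola; here `(ψ ^ 3)⁻¹` stands for
the second derivative of `f`. -/
def GraphHasParabolicChords (f r ψ : ℝ → ℝ) (p : ℝ) : Prop :=
  ∃ᶠ z in 𝓝[<] p ×ˢ 𝓝[>] p, tangentGap f r p z.1 = tangentGap f r p z.2 ∧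
    (z.2 - z.1) ^ 2 = 8 * ψ p ^ 3 * tangentGap f r p z.1

variable {f r ψ : ℝ → ℝ} {p : ℝ}

theorem not_eventually_conicRadicand_of_ne (hf : ∀ᶠ t in 𝓝 p, HasDerivAt f (r t) t)
    (hr : ∀ᶠ t in 𝓝 p, HasDerivAt r (ψ t ^ 3)⁻¹ t) (hψ : ∀ᶠ t in 𝓝 p, 0 < ψ t)
    (hchord : GraphHasParabolicChords f r ψ p) (hε : ε ≠ 0) (hD : q ^ 2 + ε * ψ p ^ 2 ≠ 0) :
    ¬∀ᶠ t in 𝓝 p, 0 ≤ ε * (conicRadicand (ψ p) q ε (t - p) - ψ t ^ 2) := by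
  intro htouch
  have hm : 0 < ψ p := hψ.self_of_nhds
  have hgap : ∀ᶠ t in 𝓝 p, HasDerivAt (tangentGap f r p) (r t - r p) t := hf.mono fun t ht =>
    ((ht.sub_const (f p)).sub (((hasDerivAt_id t).sub_const p).const_mul (r p))).congr_deriv
      (by rw [mul_one])
  have hgap_self : tangentGap f r p p = 0 := by simp [tangentGap]
  have hsmall : ∀ᶠ t in 𝓝 p, (q ^ 2 + ε * ψ p ^ 2) * tangentGap f r p t < 2 * ψ p := by
    refine (hgap.self_of_nhds.continuousAt.const_mul _).eventually_lt_const ?_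
    simpa [hgap_self] using hm
  have hnear := hsmall.and <| eventually_conic_sign (g := tangentGap f r p) hgap
    (hr.mono fun t ht => ht.sub_const (r p)) hgap_self (sub_self (r p)) hψ hD htouch
  have hside : ∀ᶠ z : ℝ × ℝ in 𝓝[<] p ×ˢ 𝓝[>] p, (z.1 < p ∧ _) ∧ p < z.2 ∧ _ :=
    (eventually_mem_nhdsWithin.and (nhdsWithin_le_nhds hnear)).prod_mk
      (eventually_mem_nhdsWithin.and (nhdsWithin_le_nhds hnear))
  obtain ⟨⟨a, b⟩, ⟨hab, hlen⟩, ⟨ha, hDa, hZa⟩, hb, -, hZb⟩ := (hchord.and_eventually hside).exists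
  simp only at hab hlen ha hDa hZa hb hZb
  rw [← hab] at hZb
  have hH : 0 < tangentGap f r p a := by
    have : 0 < 8 * ψ p ^ 3 * tangentGap f r p a := hlen ▸ pow_pos (by linarith) 2
    exact pos_of_mul_pos_right this (by positivity)
  refine sub_sq_ne_of_conic_sign hm hH hε (sub_neg.2 ha) (sub_pos.2 hb) hDa hZa hZb ?_
  rw [sub_sub_sub_cancel_right, hlen]

theorem not_eventually_conicRadicand (hf : ∀ᶠ t in 𝓝 p, HasDerivAt f (r t) t)
    (hr : ∀ᶠ t in 𝓝 p, HasDerivAt r (ψ t ^ 3)⁻¹ t) (hψ : ∀ᶠ t in 𝓝 p, 0 < ψ t)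
    (hchord : GraphHasParabolicChords f r ψ p) (hε : ε ≠ 0) :
    ¬∀ᶠ t in 𝓝 p, 0 ≤ ε * (conicRadicand (ψ p) q ε (t - p) - ψ t ^ 2) := by
  by_cases hD : q ^ 2 + ε * ψ p ^ 2 = 0
  · have hm : 0 < ψ p := hψ.self_of_nhds
    intro htouch
    refine not_eventually_conicRadicand_of_ne (q := q) (ε := ε / 2) hf hr hψ hchord
      (by positivity) (fun h => ?_) (htouch.mono fun t ht => ?_)
    · have : ε * ψ p ^ 2 = 0 := by linarith
      exact mul_ne_zero hε (by positivity) this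
    · simp only [conicRadicand] at ht ⊢
      linarith [sq_nonneg (ε * (t - p))]
  · exact not_eventually_conicRadicand_of_ne hf hr hψ hchord hε hD

/- A parabola touching `ψ²` from above or below forces the nearby chords to be shorter or longer
than those of a parabola. Hence `ψ²` is both convex and concave. -/
theorem deriv_sq_eq_of_graphHasParabolicChords {J : Set ℝ} (hJ : IsOpen J) (hJ' : J.OrdConnected)
    (hf : ∀ t ∈ J, HasDerivAt f (r t) t) (hr : ∀ t ∈ J, HasDerivAt r (ψ t ^ 3)⁻¹ t)
    (hψ : ∀ t ∈ J, 0 < ψ t) (hψd : ∀ t ∈ J, DifferentiableAt ℝ ψ t)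
    (hchord : ∀ p ∈ J, GraphHasParabolicChords f r ψ p) {t u : ℝ} (ht : t ∈ J) (hu : u ∈ J) :
    deriv (fun x => ψ x ^ 2) t = deriv (fun x => ψ x ^ 2) u := by
  have hψc : ContinuousOn ψ J := fun t ht => (hψd t ht).continuousAt.continuousWithinAt
  have htouch : ∀ p ∈ J, ∀ q ε : ℝ, ε ≠ 0 →
      ¬∀ᶠ t in 𝓝 p, 0 ≤ ε * (conicRadicand (ψ p) q ε (t - p) - ψ t ^ 2) := by
    intro p hp q ε hε
    have hmem : ∀ᶠ t in 𝓝 p, t ∈ J := hJ.mem_nhds hp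
    exact not_eventually_conicRadicand (hmem.mono hf) (hmem.mono hr) (hmem.mono hψ) (hchord p hp) hε
  refine deriv_eq_of_convexOn_of_concaveOn (g := fun x => ψ x ^ 2) ?_ ?_
    (fun t ht => (hψd t ht).fun_pow 2) ht hu
  · refine convexOn_of_forall_not_eventually_le hJ' (hψc.pow 2) fun p hp q ε hε hle => ?_
    refine htouch p hp (q / 2) ε hε.ne' (hle.mono fun t ht => mul_nonneg hε.le ?_)
    simp only [conicRadicand]
    linarith
  · refine neg_convexOn_iff.1 ?_
    refine convexOn_of_forall_not_eventually_le hJ' (hψc.pow 2).neg fun p hp q ε hε hle => ?_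
    refine htouch p hp (-q / 2) (-ε) (neg_ne_zero.2 hε.ne') (hle.mono fun t ht => ?_)
    simp only [conicRadicand, Pi.neg_apply] at ht ⊢
    exact mul_nonneg_of_nonpos_of_nonpos (by linarith) (by linarith)

end ParabolicChords

/-! ### The centroid distance -/

section Orthogonal

variable {t n v w : Plane}

theorem eq_of_inner_eq_of_orthogonal (ht : t ≠ 0) (hn : n ≠ 0) (htn : ⟪t, n⟫ = 0)
    (hvt : ⟪v, t⟫ = ⟪w, t⟫) (hvn : ⟪v, n⟫ = ⟪w, n⟫) : v = w := by
  have hli : LinearIndependent ℝ ![t, n] := by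
    refine linearIndependent_of_ne_zero_of_inner_eq_zero (fun i => ?_) fun i j hij => ?_ <;>
      fin_cases i
    · exact ht
    · exact hn
    all_goals fin_cases j <;> simp_all [real_inner_comm]
  refine InnerProductSpace.ext_inner_right_basis (𝕜 := ℝ)
    (basisOfLinearIndependentOfCardEqFinrank hli (by simp)) fun i => ?_
  rw [coe_basisOfLinearIndependentOfCardEqFinrank]
  fin_cases i
  exacts [hvt, hvn]

theorem mem_span_singleton_iff_inner_eq_zero (ht : t ≠ 0) (hn : n ≠ 0) (htn : ⟪t, n⟫ = 0) :
    v ∈ Submodule.span ℝ {t} ↔ ⟪v, n⟫ = 0 := by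
  rw [Submodule.mem_span_singleton]
  constructor
  · rintro ⟨c, rfl⟩
    rw [real_inner_smul_left, htn, mul_zero]
  · intro hv
    refine ⟨⟪v, t⟫ / ⟪t, t⟫, eq_of_inner_eq_of_orthogonal ht hn htn ?_ ?_⟩
    · rw [real_inner_smul_left, div_mul_cancel₀ _ (inner_self_ne_zero.2 ht)]
    · rw [real_inner_smul_left, htn, mul_zero, hv]

end Orthogonal

section Lines

variable {X N : ℝ → Plane} {s h : ℝ} {q : Plane}

theorem mem_tangentLine_iff : q ∈ tangentLine X s ↔ ∃ c : ℝ, X s + c • deriv X s = q := by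
  rw [tangentLine, AffineSubspace.mem_mk', vsub_eq_sub, Submodule.mem_span_singleton]
  exact exists_congr fun c => by rw [eq_sub_iff_add_eq']

theorem mem_chordLine_iff (hN : ‖N s‖ = 1) (hd : deriv X s ≠ 0) (ho : ⟪deriv X s, N s⟫ = 0) :
    q ∈ chordLine X N s h ↔ ⟪q - X s, N s⟫ = h := by
  rw [chordLine, AffineSubspace.mem_mk', vsub_eq_sub,
    mem_span_singleton_iff_inner_eq_zero hd (norm_ne_zero_iff.1 (hN ▸ one_ne_zero)) ho,
    ← sub_sub, inner_sub_left, real_inner_smul_left, real_inner_self_eq_norm_sq, hN, one_pow,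
    mul_one, sub_eq_zero]

theorem infDist_chordLine (hN : ‖N s‖ = 1) (hd : deriv X s ≠ 0) (ho : ⟪deriv X s, N s⟫ = 0)
    (h : ℝ) (q : Plane) :
    Metric.infDist q (chordLine X N s h : Set Plane) = |⟪q - X s, N s⟫ - h| := by
  have hNN : ⟪N s, N s⟫ = 1 := by rw [real_inner_self_eq_norm_sq, hN, one_pow]
  have hfoot : q - (⟪q - X s, N s⟫ - h) • N s ∈ chordLine X N s h := by
    rw [mem_chordLine_iff hN hd ho, sub_right_comm, inner_sub_left, real_inner_smul_left, hNN]
    ring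
  refine le_antisymm ?_ ((Metric.le_infDist ⟨_, hfoot⟩).2 fun p hp => ?_)
  · refine (Metric.infDist_le_dist_of_mem hfoot).trans_eq ?_
    rw [dist_eq_norm, sub_sub_cancel, norm_smul, hN, mul_one, Real.norm_eq_abs]
  · rw [SetLike.mem_coe, mem_chordLine_iff hN hd ho] at hp
    rw [← hp, ← inner_sub_left, sub_sub_sub_cancel_right, dist_eq_norm]
    simpa only [hN, mul_one] using abs_real_inner_le_norm (q - p) (N s)

end Lines

section Tangents

variable {t n A B a b : Plane}

theorem eq_div_of_add_smul_eq_add_smul {c d : ℝ} (hAB : ⟪B - A, n⟫ = 0) (hab : ⟪a + b, n⟫ = 0)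
    (hb : ⟪b, n⟫ ≠ 0) (hL : ⟪a + b, t⟫ ≠ 0) (h : A + c • a = B + d • b) :
    c = ⟪B - A, t⟫ / ⟪a + b, t⟫ := by
  have hBA : B - A = c • a - d • b := by
    rw [sub_eq_sub_iff_add_eq_add, ← h, add_comm]
  have hcd : (c + d) * ⟪b, n⟫ = 0 := by
    rw [hBA, inner_sub_left, real_inner_smul_left, real_inner_smul_left] at hAB
    rw [inner_add_left] at hab
    linear_combination c * hab - hAB
  rw [mul_eq_zero, or_iff_left hb, add_eq_zero_iff_eq_neg'] at hcd
  rw [eq_div_iff hL, hBA, hcd, neg_smul, sub_neg_eq_add, ← smul_add, real_inner_smul_left]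

theorem exists_add_smul_eq_add_smul (ht : t ≠ 0) (hn : n ≠ 0) (htn : ⟪t, n⟫ = 0)
    (hAB : ⟪B - A, n⟫ = 0) (hab : ⟪a + b, n⟫ = 0) (hL : ⟪a + b, t⟫ ≠ 0) :
    ∃ c d : ℝ, A + c • a = B + d • b := by
  set c := ⟪B - A, t⟫ / ⟪a + b, t⟫
  have hBA : B - A = c • (a + b) := eq_of_inner_eq_of_orthogonal ht hn htn
    (by rw [real_inner_smul_left, div_mul_cancel₀ _ hL])
    (by rw [real_inner_smul_left, hAB, hab, mul_zero])
  refine ⟨c, -c, ?_⟩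
  rw [sub_eq_iff_eq_add] at hBA
  rw [hBA]
  module

end Tangents

namespace IsStrictlyLocallyConvex

variable {I : Set ℝ} {X N : ℝ → Plane} {s : ℝ}

theorem contDiffAt (hX : IsStrictlyLocallyConvex I X N) (hs : s ∈ I) : ContDiffAt ℝ 3 X s :=
  hX.contDiffOn.contDiffAt (hX.isOpen.mem_nhds hs)

theorem contDiffAt_deriv (hX : IsStrictlyLocallyConvex I X N) (hs : s ∈ I) :
    ContDiffAt ℝ 2 (deriv X) s :=
  (hX.contDiffAt hs).derivWithin (by norm_num)

theorem hasDerivAt (hX : IsStrictlyLocallyConvex I X N) (hs : s ∈ I) :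
    HasDerivAt X (deriv X s) s :=
  ((hX.contDiffAt hs).differentiableAt three_ne_zero).hasDerivAt

theorem hasDerivAt_deriv (hX : IsStrictlyLocallyConvex I X N) (hs : s ∈ I) :
    HasDerivAt (deriv X) (deriv (deriv X) s) s :=
  ((hX.contDiffAt_deriv hs).differentiableAt two_ne_zero).hasDerivAt

theorem normal_ne_zero (hX : IsStrictlyLocallyConvex I X N) (hs : s ∈ I) : N s ≠ 0 :=
  norm_ne_zero_iff.1 (hX.norm_normal s hs ▸ one_ne_zero)

theorem inner_deriv_deriv_normal_pos (hX : IsStrictlyLocallyConvex I X N) (hs : s ∈ I) :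
    0 < ⟪deriv (deriv X) s, N s⟫ :=
  (div_pos_iff_of_pos_right (pow_pos (norm_pos_iff.2 (hX.regular s hs)) 2)).1
    (hX.curvature_pos s hs)

end IsStrictlyLocallyConvex

/-- `ρ` is the parameter of the curve near `X s` for which `X (ρ θ)` has height `θ ^ 2` above the
tangent line at `X s`, so that `X (ρ (-θ))` and `X (ρ θ)` are the endpoints of the chord at height
`θ ^ 2`. -/
structure IsChordParam (X N : ℝ → Plane) (s : ℝ) (ρ : ℝ → ℝ) : Prop where
  contDiffAt : ContDiffAt ℝ 1 ρ 0
  map_zero : ρ 0 = s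
  deriv_pos : 0 < deriv ρ 0
  mul_deriv_sq : ⟪deriv (deriv X) s, N s⟫ * deriv ρ 0 ^ 2 = 2
  inner_sub : ∀ᶠ θ in 𝓝 0, ⟪X (ρ θ) - X s, N s⟫ = θ ^ 2

section ChordParam

variable {I : Set ℝ} {X N : ℝ → Plane} {s : ℝ} {ρ : ℝ → ℝ}

theorem IsStrictlyLocallyConvex.exists_isChordParam (hX : IsStrictlyLocallyConvex I X N)
    (hs : s ∈ I) : ∃ ρ, IsChordParam X N s ρ := by
  have hη' : ∀ u ∈ I, HasDerivAt (fun u => ⟪X u - X s, N s⟫) ⟪deriv X u, N s⟫ u := fun u hu => by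
    simpa using ((hX.hasDerivAt hu).sub_const (X s)).inner ℝ (hasDerivAt_const u (N s))
  have hη'' : HasDerivAt (deriv fun u => ⟪X u - X s, N s⟫) ⟪deriv (deriv X) s, N s⟫ s := by
    have h : HasDerivAt (fun u => ⟪deriv X u, N s⟫) ⟪deriv (deriv X) s, N s⟫ s := by
      simpa using (hX.hasDerivAt_deriv hs).inner ℝ (hasDerivAt_const s (N s))
    exact h.congr_of_eventuallyEq
      ((hX.isOpen.eventually_mem hs).mono fun u hu => (hη' u hu).deriv)
  obtain ⟨ρ, hρ, hρ0, hpos, hsq, hη⟩ := exists_morse_param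
    ((((hX.contDiffAt hs).of_le (by norm_num)).sub contDiffAt_const).inner ℝ
      (contDiffAt_const (c := N s)))
    (by rw [sub_self, inner_zero_left]) (by rw [(hη' s hs).deriv, hX.inner_normal s hs])
    (by rw [hη''.deriv]; exact hX.inner_deriv_deriv_normal_pos hs)
  exact ⟨ρ, hρ, hρ0, hpos, by rwa [hη''.deriv] at hsq, hη⟩

namespace IsChordParam

theorem eventually_mem (hρ : IsChordParam X N s ρ) (hX : IsStrictlyLocallyConvex I X N)
    (hs : s ∈ I) : ∀ᶠ θ in 𝓝 0, ρ θ ∈ I :=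
  hρ.contDiffAt.continuousAt.eventually (hρ.map_zero ▸ hX.isOpen.eventually_mem hs)

theorem eventually_param_eq (hρ : IsChordParam X N s ρ) (hX : IsStrictlyLocallyConvex I X N)
    (hs : s ∈ I) :
    ∀ᶠ θ in 𝓝[>] 0, paramA I X N s (θ ^ 2) = ρ (-θ) ∧ paramB I X N s (θ ^ 2) = ρ θ := by
  obtain ⟨ε, hε, hmono, hspec⟩ := exists_strictMonoOn_Ioo_of_deriv_pos hρ.contDiffAt hρ.deriv_pos
    ((hρ.eventually_mem hX hs).and
      (hρ.inner_sub.and (hρ.contDiffAt.eventually (by norm_num))))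
  rw [zero_sub, zero_add] at hmono hspec
  filter_upwards [Ioo_mem_nhdsGT hε] with θ ⟨hθ0, hθε⟩
  have hsub : Set.Icc (-θ) θ ⊆ Set.Ioo (-ε) ε := Set.Icc_subset_Ioo (neg_lt_neg hθε) hθε
  have hmem0 : (0 : ℝ) ∈ Set.Ioo (-ε) ε := hsub ⟨by linarith, hθ0.le⟩
  have hmem : θ ∈ Set.Ioo (-ε) ε := hsub ⟨by linarith, le_rfl⟩
  have hmem' : -θ ∈ Set.Ioo (-ε) ε := hsub ⟨le_rfl, by linarith⟩
  have hlt : s < ρ θ := hρ.map_zero ▸ hmono hmem0 hmem hθ0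
  have hlt' : ρ (-θ) < s := hρ.map_zero ▸ hmono hmem' hmem0 (neg_lt_zero.2 hθ0)
  have hline (u : ℝ) : X u ∈ chordLine X N s (θ ^ 2) ↔ ⟪X u - X s, N s⟫ = θ ^ 2 :=
    mem_chordLine_iff (hX.norm_normal s hs) (hX.regular s hs) (hX.inner_normal s hs)
  have hends : ∀ u ∈ Set.Icc (ρ (-θ)) (ρ θ), X u ∈ chordLine X N s (θ ^ 2) →
      u = ρ θ ∨ u = ρ (-θ) := by
    intro u hu hline_u
    obtain ⟨θ', hθ', rfl⟩ := intermediate_value_Icc (by linarith)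
      (fun x hx => (hspec x (hsub hx)).2.2.continuousAt.continuousWithinAt) hu
    rw [hline, (hspec θ' (hsub hθ')).2.1, sq_eq_sq_iff_eq_or_eq_neg] at hline_u
    exact hline_u.imp (congrArg ρ) (congrArg ρ)
  constructor
  · refine IsGreatest.csSup_eq ⟨⟨(hspec _ hmem').1, hlt', ?_⟩, fun u ⟨_, hus, hu⟩ => ?_⟩
    · rw [hline, (hspec _ hmem').2.1, neg_sq]
    · by_contra! hgt
      rcases hends u ⟨hgt.le, (hus.trans hlt).le⟩ hu with rfl | rfl
      exacts [hus.not_gt hlt, hgt.false]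
  · refine IsLeast.csInf_eq ⟨⟨(hspec _ hmem).1, hlt, ?_⟩, fun u ⟨_, hus, hu⟩ => ?_⟩
    · rw [hline, (hspec _ hmem).2.1]
    · by_contra! hgt
      rcases hends u ⟨(hlt'.trans hus).le, hgt.le⟩ hu with rfl | rfl
      exacts [hgt.false, hus.not_gt hlt']

theorem eventually_hasDerivAt_comp (hρ : IsChordParam X N s ρ)
    (hX : IsStrictlyLocallyConvex I X N) (hs : s ∈ I) :
    ∀ᶠ θ in 𝓝 0, HasDerivAt (X ∘ ρ) (deriv ρ θ • deriv X (ρ θ)) θ := by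
  filter_upwards [hρ.eventually_mem hX hs, hρ.contDiffAt.eventually (by norm_num)] with θ hθ hθ'
  exact (hX.hasDerivAt hθ).scomp θ (hθ'.differentiableAt one_ne_zero).hasDerivAt

theorem eventually_deriv_pos (hρ : IsChordParam X N s ρ) : ∀ᶠ θ in 𝓝 0, 0 < deriv ρ θ :=
  (hρ.contDiffAt.derivWithin (m := 0) (by norm_num)).continuousAt.eventually
    (lt_mem_nhds hρ.deriv_pos)

theorem eventually_inner_deriv (hρ : IsChordParam X N s ρ)
    (hX : IsStrictlyLocallyConvex I X N) (hs : s ∈ I) :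
    ∀ᶠ θ in 𝓝 0, ⟪deriv ρ θ • deriv X (ρ θ), N s⟫ = 2 * θ := by
  filter_upwards [hρ.eventually_hasDerivAt_comp hX hs, hρ.inner_sub.eventually_nhds] with θ hY hη
  have h := (hY.sub_const (X s)).inner ℝ (hasDerivAt_const θ (N s))
  rw [inner_zero_right, zero_add] at h
  refine (h.congr_of_eventuallyEq ?_).unique (by simpa using hasDerivAt_pow 2 θ)
  exact hη.mono fun x hx => hx.symm

end IsChordParam

/-- The length of the chord `X (ρ (-θ)) X (ρ θ)`, multiplied by `‖X' s‖`. -/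
def chord (X : ℝ → Plane) (s : ℝ) (ρ : ℝ → ℝ) (θ : ℝ) : ℝ :=
  ⟪X (ρ θ) - X (ρ (-θ)), deriv X s⟫

theorem chord_zero : chord X s ρ 0 = 0 := by
  rw [chord, neg_zero, sub_self, inner_zero_left]

namespace IsChordParam

theorem contDiffAt_chord (hρ : IsChordParam X N s ρ) (hX : IsStrictlyLocallyConvex I X N)
    (hs : s ∈ I) : ContDiffAt ℝ 1 (chord X s ρ) 0 := by
  have hY : ContDiffAt ℝ 1 (X ∘ ρ) 0 :=
    ContDiffAt.comp 0 (hρ.map_zero ▸ (hX.contDiffAt hs).of_le (by norm_num)) hρ.contDiffAt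
  have hY' : ContDiffAt ℝ 1 (fun θ => (X ∘ ρ) (-θ)) 0 :=
    ContDiffAt.comp (g := X ∘ ρ) 0 (by rwa [neg_zero]) contDiffAt_id.neg
  exact (hY.sub hY').inner ℝ contDiffAt_const

theorem eventually_deriv_chord (hρ : IsChordParam X N s ρ) (hX : IsStrictlyLocallyConvex I X N)
    (hs : s ∈ I) :
    ∀ᶠ θ in 𝓝 0, deriv (chord X s ρ) θ =
      ⟪deriv ρ (-θ) • deriv X (ρ (-θ)) + deriv ρ θ • deriv X (ρ θ), deriv X s⟫ := by
  have hY := hρ.eventually_hasDerivAt_comp hX hs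
  filter_upwards [hY, (continuous_neg.tendsto' (0 : ℝ) 0 neg_zero).eventually hY] with θ hθ hθ'
  have h := (hθ.sub (hθ'.scomp θ (hasDerivAt_neg θ))).inner ℝ (hasDerivAt_const θ (deriv X s))
  rw [inner_zero_right, zero_add, neg_one_smul, sub_neg_eq_add, add_comm] at h
  exact h.deriv

theorem deriv_chord_zero (hρ : IsChordParam X N s ρ) (hX : IsStrictlyLocallyConvex I X N)
    (hs : s ∈ I) : deriv (chord X s ρ) 0 = 2 * deriv ρ 0 * ‖deriv X s‖ ^ 2 := by
  rw [(hρ.eventually_deriv_chord hX hs).self_of_nhds, neg_zero, hρ.map_zero, ← two_smul ℝ,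
    real_inner_smul_left, real_inner_smul_left, real_inner_self_eq_norm_sq, mul_assoc]

theorem deriv_chord_zero_pos (hρ : IsChordParam X N s ρ) (hX : IsStrictlyLocallyConvex I X N)
    (hs : s ∈ I) : 0 < deriv (chord X s ρ) 0 := by
  rw [hρ.deriv_chord_zero hX hs]
  exact mul_pos (mul_pos two_pos hρ.deriv_pos) (pow_pos (norm_pos_iff.2 (hX.regular s hs)) 2)

theorem eventually_deriv_chord_pos (hρ : IsChordParam X N s ρ)
    (hX : IsStrictlyLocallyConvex I X N) (hs : s ∈ I) :
    ∀ᶠ θ in 𝓝 0, 0 < deriv (chord X s ρ) θ :=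
  ((hρ.contDiffAt_chord hX hs).derivWithin (m := 0) (by norm_num)).continuousAt.eventually
    (lt_mem_nhds (hρ.deriv_chord_zero_pos hX hs))

end IsChordParam

theorem smul_deriv_mem_tangentLine_iff {c u : ℝ} {q : Plane} (hc : c ≠ 0) :
    q ∈ tangentLine X u ↔ ∃ d : ℝ, X u + d • c • deriv X u = q := by
  rw [mem_tangentLine_iff]
  constructor <;> rintro ⟨d, rfl⟩
  · exact ⟨d / c, by rw [smul_smul, div_mul_cancel₀ _ hc]⟩
  · exact ⟨d * c, by rw [smul_smul]⟩

theorem inner_centroid_sub {P A B Q n : Plane} {h : ℝ} (hA : ⟪A - P, n⟫ = h) (hB : ⟪B - P, n⟫ = h) :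
    ⟪(1 / 3 : ℝ) • (Q + A + B) - P, n⟫ - h = 1 / 3 * ⟪Q - A, n⟫ := by
  have hsplit : (1 / 3 : ℝ) • (Q + A + B) - P =
      (1 / 3 : ℝ) • ((Q - A) + (2 : ℝ) • (A - P) + (B - P)) := by module
  rw [hsplit, real_inner_smul_left, inner_add_left, inner_add_left, real_inner_smul_left, hA, hB]
  ring

theorem pointQ_mem_tangentLine {h : ℝ}
    (hex : ∃ q, q ∈ tangentLine X (paramA I X N s h) ∧ q ∈ tangentLine X (paramB I X N s h)) :
    pointQ I X N s h ∈ tangentLine X (paramA I X N s h) ∧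
      pointQ I X N s h ∈ tangentLine X (paramB I X N s h) :=
  Classical.epsilon_spec hex

namespace IsChordParam

theorem eventually_inner_pointQ_sub (hρ : IsChordParam X N s ρ)
    (hX : IsStrictlyLocallyConvex I X N) (hs : s ∈ I) :
    ∀ᶠ θ in 𝓝[>] 0, ⟪pointQ I X N s (θ ^ 2) - X (ρ (-θ)), N s⟫ =
      -(2 * θ) * (chord X s ρ θ / deriv (chord X s ρ) θ) := by
  have hside : ∀ᶠ θ in 𝓝 0, ⟪X (ρ θ) - X s, N s⟫ = θ ^ 2 ∧
      ⟪deriv ρ θ • deriv X (ρ θ), N s⟫ = 2 * θ ∧ 0 < deriv ρ θ :=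
    hρ.inner_sub.and ((hρ.eventually_inner_deriv hX hs).and hρ.eventually_deriv_pos)
  filter_upwards [hρ.eventually_param_eq hX hs, self_mem_nhdsWithin, nhdsWithin_le_nhds hside,
    nhdsWithin_le_nhds ((continuous_neg.tendsto' (0 : ℝ) 0 neg_zero).eventually hside),
    nhdsWithin_le_nhds (hρ.eventually_deriv_chord hX hs),
    nhdsWithin_le_nhds (hρ.eventually_deriv_chord_pos hX hs)]
    with θ ⟨hA, hB⟩ hθ ⟨hBh, hbn, hb⟩ ⟨hAh, han, ha⟩ hL' hLpos
  set a := deriv ρ (-θ) • deriv X (ρ (-θ)) with ha_def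
  set b := deriv ρ θ • deriv X (ρ θ)
  have hAB : ⟪X (ρ θ) - X (ρ (-θ)), N s⟫ = 0 := by
    rw [← sub_sub_sub_cancel_right _ _ (X s), inner_sub_left, hBh, hAh, neg_sq, sub_self]
  have hab : ⟪a + b, N s⟫ = 0 := by rw [inner_add_left, han, hbn]; ring
  have hb0 : ⟪b, N s⟫ ≠ 0 := hbn ▸ mul_ne_zero two_ne_zero (ne_of_gt hθ)
  have hL : ⟪a + b, deriv X s⟫ ≠ 0 := hL' ▸ hLpos.ne'
  have hQ : ∃ q, q ∈ tangentLine X (paramA I X N s (θ ^ 2)) ∧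
      q ∈ tangentLine X (paramB I X N s (θ ^ 2)) := by
    obtain ⟨c, d, hcd⟩ := exists_add_smul_eq_add_smul (hX.regular s hs) (hX.normal_ne_zero hs)
      (hX.inner_normal s hs) hAB hab hL
    rw [hA, hB]
    exact ⟨X (ρ (-θ)) + c • a, (smul_deriv_mem_tangentLine_iff ha.ne').2 ⟨c, rfl⟩,
      (smul_deriv_mem_tangentLine_iff hb.ne').2 ⟨d, hcd.symm⟩⟩
  have hQ' := pointQ_mem_tangentLine hQ
  rw [hA, hB, smul_deriv_mem_tangentLine_iff ha.ne',
    smul_deriv_mem_tangentLine_iff hb.ne'] at hQ'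
  obtain ⟨⟨c, hc⟩, d, hd⟩ := hQ'
  have hc' : c = chord X s ρ θ / deriv (chord X s ρ) θ :=
    hL' ▸ eq_div_of_add_smul_eq_add_smul hAB hab hb0 hL (hc.trans hd.symm)
  rw [← hc, add_sub_cancel_left, real_inner_smul_left, ← ha_def, han, ← hc']
  ring

theorem tendsto_chord_div (hρ : IsChordParam X N s ρ) (hX : IsStrictlyLocallyConvex I X N)
    (hs : s ∈ I) :
    Tendsto (fun θ => chord X s ρ θ / θ) (𝓝[>] 0) (𝓝 (deriv (chord X s ρ) 0)) :=
  tendsto_div_self_of_zero ((hρ.contDiffAt_chord hX hs).differentiableAt one_ne_zero) chord_zero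

theorem eventually_distJ_eq (hρ : IsChordParam X N s ρ) (hX : IsStrictlyLocallyConvex I X N)
    (hs : s ∈ I) :
    ∀ᶠ θ in 𝓝[>] 0, distJ I X N s (θ ^ 2) =
      2 / 3 * θ * (chord X s ρ θ / deriv (chord X s ρ) θ) := by
  filter_upwards [hρ.eventually_param_eq hX hs, self_mem_nhdsWithin,
    hρ.eventually_inner_pointQ_sub hX hs, nhdsWithin_le_nhds hρ.inner_sub,
    nhdsWithin_le_nhds ((continuous_neg.tendsto' (0 : ℝ) 0 neg_zero).eventually hρ.inner_sub),
    nhdsWithin_le_nhds (hρ.eventually_deriv_chord_pos hX hs),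
    (hρ.tendsto_chord_div hX hs).eventually (lt_mem_nhds (hρ.deriv_chord_zero_pos hX hs))]
    with θ ⟨hA, hB⟩ hθ hQ hBh hAh hL' hL
  rw [neg_sq] at hAh
  have hratio : 0 < chord X s ρ θ / deriv (chord X s ρ) θ :=
    div_pos ((div_pos_iff_of_pos_right hθ).1 hL) hL'
  rw [distJ, infDist_chordLine (hX.norm_normal s hs) (hX.regular s hs) (hX.inner_normal s hs),
    centroidJ, pointA, pointB, hA, hB, inner_centroid_sub hAh hBh, hQ, neg_mul, mul_neg, abs_neg,
    abs_of_pos (mul_pos (by norm_num) (mul_pos (mul_pos two_pos hθ) hratio))]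
  ring

theorem eventually_distJ_eq_two_thirds_mul_iff (hρ : IsChordParam X N s ρ)
    (hX : IsStrictlyLocallyConvex I X N) (hs : s ∈ I) :
    (∀ᶠ h in 𝓝[>] 0, distJ I X N s h = 2 / 3 * h) ↔
      ∀ᶠ θ in 𝓝[>] 0, chord X s ρ θ = deriv (chord X s ρ) 0 * θ := by
  rw [eventually_nhdsGT_zero_iff_sq,
    ← eventually_eq_mul_deriv_iff (hρ.contDiffAt_chord hX hs) chord_zero]
  refine eventually_congr ?_
  filter_upwards [hρ.eventually_distJ_eq hX hs, self_mem_nhdsWithin,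
    nhdsWithin_le_nhds (hρ.eventually_deriv_chord_pos hX hs)] with θ hJ hθ hL'
  rw [hJ, sq, ← mul_assoc, mul_right_inj' (mul_ne_zero (by norm_num) (ne_of_gt hθ)),
    div_eq_iff hL'.ne']

theorem tendsto_distJ_div (hρ : IsChordParam X N s ρ) (hX : IsStrictlyLocallyConvex I X N)
    (hs : s ∈ I) : Tendsto (fun h => distJ I X N s h / h) (𝓝[>] 0) (𝓝 (2 / 3)) := by
  have hL' := ((hρ.contDiffAt_chord hX hs).derivWithin (m := 0) (by norm_num)).continuousAt.tendsto
  have hlim : Tendsto (fun θ => 2 / 3 * (chord X s ρ θ / θ / deriv (chord X s ρ) θ)) (𝓝[>] 0)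
      (𝓝 (2 / 3)) := by
    have h := ((hρ.tendsto_chord_div hX hs).div (hL'.mono_left nhdsWithin_le_nhds)
      (hρ.deriv_chord_zero_pos hX hs).ne').const_mul (2 / 3 : ℝ)
    rwa [div_self (hρ.deriv_chord_zero_pos hX hs).ne', mul_one] at h
  refine fun U hU => eventually_nhdsGT_zero_iff_sq.2 ((hlim.congr' ?_).eventually hU)
  filter_upwards [hρ.eventually_distJ_eq hX hs, self_mem_nhdsWithin] with θ hJ hθ
  have hθ0 : θ ≠ 0 := ne_of_gt hθ
  rw [hJ]
  field_simp

end IsChordParam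

end ChordParam

theorem IsStrictlyLocallyConvex.eventually_distJ_of_eq_mul_rpow {I : Set ℝ} {X N : ℝ → Plane}
    {s : ℝ} (hX : IsStrictlyLocallyConvex I X N) (hs : s ∈ I) {l m : ℝ}
    (h : ∀ᶠ h in 𝓝[>] 0, distJ I X N s h = l * h ^ m) :
    ∀ᶠ h in 𝓝[>] 0, distJ I X N s h = 2 / 3 * h := by
  obtain ⟨ρ, hρ⟩ := hX.exists_isChordParam hs
  obtain ⟨rfl, rfl⟩ := eq_of_tendsto_mul_rpow_div (by norm_num)
    ((hρ.tendsto_distJ_div hX hs).congr' (h.mono fun x hx => by rw [hx]))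
  simpa only [Real.rpow_one] using h

/-! ### Parabolas -/

section Parabola

/-- The parametrization `t ↦ Y + t v + (t² / 2) ξ` of a parabola. For `⟪v, ξ⟫ = 0` its vertex is
`Y` and its axis is spanned by `ξ`. -/
def parabolaPoint (Y v ξ : Plane) (t : ℝ) : Plane := Y + t • v + (t ^ 2 / 2) • ξ

/-- The parameter of a point on the parabola `Set.range (parabolaPoint Y v ξ)`, for
`⟪v, ξ⟫ = 0`. -/
def parabolaParam (Y v x : Plane) : ℝ := ⟪x - Y, v⟫ / ‖v‖ ^ 2

variable {Y v ξ : Plane}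

theorem parabolaParam_parabolaPoint (hv : v ≠ 0) (hvξ : ⟪v, ξ⟫ = 0) (t : ℝ) :
    parabolaParam Y v (parabolaPoint Y v ξ t) = t := by
  have hv' := norm_ne_zero_iff.2 hv
  rw [parabolaParam, parabolaPoint, add_assoc, add_sub_cancel_left, inner_add_left,
    real_inner_smul_left, real_inner_smul_left, real_inner_comm v ξ, hvξ,
    real_inner_self_eq_norm_sq, mul_zero, add_zero, mul_div_cancel_right₀ _ (pow_ne_zero 2 hv')]

theorem parabolaPoint_parabolaParam (hv : v ≠ 0) (hvξ : ⟪v, ξ⟫ = 0) {x : Plane}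
    (hx : x ∈ Set.range (parabolaPoint Y v ξ)) : parabolaPoint Y v ξ (parabolaParam Y v x) = x := by
  obtain ⟨t, rfl⟩ := hx
  rw [parabolaParam_parabolaPoint hv hvξ]

theorem parabolaPoint_sub (t t₀ : ℝ) : parabolaPoint Y v ξ t - parabolaPoint Y v ξ t₀ =
    (t - t₀) • (v + t₀ • ξ) + ((t - t₀) ^ 2 / 2) • ξ := by
  simp only [parabolaPoint]
  module

theorem hasDerivAt_parabolaPoint_comp {τ : ℝ → ℝ} {τ' u : ℝ} (hτ : HasDerivAt τ τ' u) :
    HasDerivAt (fun u => parabolaPoint Y v ξ (τ u)) (τ' • (v + τ u • ξ)) u := by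
  refine (((hτ.smul_const v).const_add Y).add
    (((hτ.pow 2).div_const 2).smul_const ξ)).congr_deriv ?_
  push_cast
  module

theorem exists_eq_smul_add_smul_of_orthogonal {n : Plane} (hv : v ≠ 0) (hn : n ≠ 0)
    (hvn : ⟪v, n⟫ = 0) (w : Plane) : ∃ a b : ℝ, w = a • v + b • n := by
  have hv' := norm_ne_zero_iff.2 hv
  have hn' := norm_ne_zero_iff.2 hn
  refine ⟨⟪w, v⟫ / ‖v‖ ^ 2, ⟪w, n⟫ / ‖n‖ ^ 2, eq_of_inner_eq_of_orthogonal hv hn hvn ?_ ?_⟩ <;>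
    rw [inner_add_left, real_inner_smul_left, real_inner_smul_left, real_inner_self_eq_norm_sq]
  · rw [real_inner_comm v n, hvn, mul_zero, add_zero, div_mul_cancel₀ _ (pow_ne_zero 2 hv')]
  · rw [hvn, mul_zero, zero_add, div_mul_cancel₀ _ (pow_ne_zero 2 hn')]

theorem dist_add_smul_add_smul_eq_abs_iff {F n : Plane} {d : ℝ} (hn : ‖n‖ = 1) (hvn : ⟪v, n⟫ = 0)
    (a b : ℝ) : dist (F + a • v + b • n) F = |⟪n, F + a • v + b • n⟫ - (⟪n, F⟫ - d)| ↔
      a ^ 2 * ‖v‖ ^ 2 = d ^ 2 + 2 * b * d := by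
  have hnorm : ‖F + a • v + b • n - F‖ ^ 2 = a ^ 2 * ‖v‖ ^ 2 + b ^ 2 := by
    rw [add_assoc, add_sub_cancel_left, norm_add_sq_real, norm_smul, norm_smul, hn,
      real_inner_smul_left, real_inner_smul_right, hvn, mul_pow, mul_pow, Real.norm_eq_abs,
      Real.norm_eq_abs, sq_abs, sq_abs]
    ring
  have hinner : ⟪n, F + a • v + b • n⟫ - (⟪n, F⟫ - d) = b + d := by
    rw [inner_add_right, inner_add_right, real_inner_smul_right, real_inner_smul_right,
      real_inner_comm v n, hvn, real_inner_self_eq_norm_sq, hn]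
    ring
  rw [dist_eq_norm, ← abs_norm, ← sq_eq_sq_iff_abs_eq_abs, hnorm, hinner]
  constructor <;> intro h <;> linarith

theorem setOf_dist_eq_abs_eq_range {F n : Plane} {d : ℝ} (hn : ‖n‖ = 1) (hd : d ≠ 0) (hv : v ≠ 0)
    (hvn : ⟪v, n⟫ = 0) : {x | dist x F = |⟪n, x⟫ - (⟪n, F⟫ - d)|} =
      Set.range (parabolaPoint (F - (d / 2) • n) v ((‖v‖ ^ 2 / d) • n)) := by
  have hpoint (t : ℝ) : parabolaPoint (F - (d / 2) • n) v ((‖v‖ ^ 2 / d) • n) t =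
      F + t • v + (t ^ 2 * ‖v‖ ^ 2 / (2 * d) - d / 2) • n := by
    simp only [parabolaPoint]
    module
  ext x
  constructor
  · intro hx
    obtain ⟨a, b, hab⟩ := exists_eq_smul_add_smul_of_orthogonal hv
      (norm_ne_zero_iff.1 (hn ▸ one_ne_zero)) hvn (x - F)
    obtain rfl : x = F + a • v + b • n := by rw [add_assoc, ← hab, add_sub_cancel]
    rw [Set.mem_ofPred_eq, dist_add_smul_add_smul_eq_abs_iff hn hvn] at hx
    refine ⟨a, (hpoint a).trans ?_⟩
    rw [hx]
    congr
    field_simp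
    ring
  · rintro ⟨t, rfl⟩
    rw [Set.mem_ofPred_eq, hpoint, dist_add_smul_add_smul_eq_abs_iff hn hvn]
    field_simp
    ring

theorem isParabola_iff_exists_eq_range {C : Set Plane} :
    IsParabola C ↔ ∃ Y v ξ, v ≠ 0 ∧ ξ ≠ 0 ∧ ⟪v, ξ⟫ = 0 ∧ C = Set.range (parabolaPoint Y v ξ) := by
  constructor
  · rintro ⟨F, n, c, hn, hc, rfl⟩
    have hd : ⟪n, F⟫ - c ≠ 0 := sub_ne_zero.2 hc
    have hn0 : n ≠ 0 := norm_ne_zero_iff.1 (hn ▸ one_ne_zero)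
    set v := (EuclideanSpace.basisFun (Fin 2) ℝ).toBasis.orientation.rightAngleRotation n with hv
    have hv0 : v ≠ 0 := by simpa [hv] using hn0
    have hvn : ⟪v, n⟫ = 0 := by simp [hv]
    refine ⟨F - ((⟪n, F⟫ - c) / 2) • n, v, (‖v‖ ^ 2 / (⟪n, F⟫ - c)) • n, hv0,
      smul_ne_zero (div_ne_zero (pow_ne_zero 2 (norm_ne_zero_iff.2 hv0)) hd) hn0,
      by rw [real_inner_smul_right, hvn, mul_zero], ?_⟩
    rw [← setOf_dist_eq_abs_eq_range hn hd hv0 hvn, sub_sub_cancel]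
  · rintro ⟨Y, v, ξ, hv, hξ, hvξ, rfl⟩
    have hξ' := norm_pos_iff.2 hξ
    set n := ‖ξ‖⁻¹ • ξ with hn
    set d := ‖v‖ ^ 2 / ‖ξ‖ with hd
    have hd0 : d ≠ 0 := by positivity
    have hn1 : ‖n‖ = 1 := norm_smul_inv_norm hξ
    have hvn : ⟪v, n⟫ = 0 := by rw [hn, real_inner_smul_right, hvξ, mul_zero]
    have hξn : (‖v‖ ^ 2 / d) • n = ξ := by
      rw [hn, hd, smul_smul, div_div_cancel₀ (by positivity), mul_inv_cancel₀ hξ'.ne', one_smul]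
    refine ⟨Y + (d / 2) • n, n, ⟪n, Y + (d / 2) • n⟫ - d, hn1,
      fun h => hd0 (sub_eq_self.1 h.symm), ?_⟩
    rw [setOf_dist_eq_abs_eq_range hn1 hd0 hv hvn, add_sub_cancel_right, hξn]

end Parabola

namespace IsStrictlyLocallyConvex

variable {I : Set ℝ} {X N : ℝ → Plane} {s : ℝ} {Y v ξ : Plane}

theorem contDiffAt_parabolaParam (hX : IsStrictlyLocallyConvex I X N) (hs : s ∈ I) :
    ContDiffAt ℝ 3 (fun u => parabolaParam Y v (X u)) s :=
  (((hX.contDiffAt hs).sub contDiffAt_const).inner ℝ contDiffAt_const).div_const _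

theorem deriv_eq_of_subset_parabola (hX : IsStrictlyLocallyConvex I X N) (hv : v ≠ 0)
    (hvξ : ⟪v, ξ⟫ = 0) (hsub : ∀ u ∈ I, X u ∈ Set.range (parabolaPoint Y v ξ)) (hs : s ∈ I) :
    deriv X s = deriv (fun u => parabolaParam Y v (X u)) s •
      (v + parabolaParam Y v (X s) • ξ) := by
  have hτ := ((hX.contDiffAt_parabolaParam (Y := Y) (v := v) hs).differentiableAt
    three_ne_zero).hasDerivAt
  refine ((hasDerivAt_parabolaPoint_comp (Y := Y) (ξ := ξ) hτ).congr_of_eventuallyEq ?_).deriv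
  filter_upwards [hX.isOpen.eventually_mem hs] with u hu
  exact (parabolaPoint_parabolaParam hv hvξ (hsub u hu)).symm

theorem isOpenPartOfParabola_of_subset (hX : IsStrictlyLocallyConvex I X N) (hv : v ≠ 0)
    (hξ : ξ ≠ 0) (hvξ : ⟪v, ξ⟫ = 0) (hsub : ∀ u ∈ I, X u ∈ Set.range (parabolaPoint Y v ξ)) :
    IsOpenPartOfParabola I X := by
  have hopen : IsOpen ((fun u => parabolaParam Y v (X u)) '' I) := by
    refine isOpen_iff_mem_nhds.2 ?_
    rintro _ ⟨u, hu, rfl⟩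
    have hderiv : deriv (fun u => parabolaParam Y v (X u)) u ≠ 0 := fun h =>
      hX.regular u hu (by rw [hX.deriv_eq_of_subset_parabola hv hvξ hsub hu, h, zero_smul])
    rw [← ((hX.contDiffAt_parabolaParam hu).hasStrictDerivAt three_ne_zero).map_nhds_eq hderiv]
    exact image_mem_map (hX.isOpen.mem_nhds hu)
  refine ⟨_, isParabola_iff_exists_eq_range.2 ⟨Y, v, ξ, hv, hξ, hvξ, rfl⟩, _,
    hopen.preimage (f := parabolaParam Y v) (by unfold parabolaParam; fun_prop),
    Set.Subset.antisymm ?_ ?_⟩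
  · rintro _ ⟨u, hu, rfl⟩
    exact ⟨hsub u hu, u, hu, rfl⟩
  · rintro x ⟨hx, u, hu, hux : parabolaParam Y v (X u) = parabolaParam Y v x⟩
    refine ⟨u, hu, ?_⟩
    rw [← parabolaPoint_parabolaParam hv hvξ (hsub u hu), hux,
      parabolaPoint_parabolaParam hv hvξ hx]

end IsStrictlyLocallyConvex

theorem IsChordParam.eventually_chord_eq_of_sq_eq {I : Set ℝ} {X N : ℝ → Plane} {s : ℝ}
    {ρ : ℝ → ℝ} (hρ : IsChordParam X N s ρ) (hX : IsStrictlyLocallyConvex I X N) (hs : s ∈ I)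
    {K : ℝ} (h : ∀ᶠ θ in 𝓝[>] 0, chord X s ρ θ ≠ 0 → chord X s ρ θ ^ 2 = K * θ ^ 2) :
    ∀ᶠ θ in 𝓝[>] 0, chord X s ρ θ = deriv (chord X s ρ) 0 * θ := by
  have hlim := hρ.tendsto_chord_div hX hs
  have hC := hρ.deriv_chord_zero_pos hX hs
  have hpos : ∀ᶠ θ in 𝓝[>] (0 : ℝ), 0 < θ ∧ 0 < chord X s ρ θ := by
    filter_upwards [hlim.eventually_const_lt hC, self_mem_nhdsWithin] with θ hθ (hθ0 : 0 < θ)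
    exact ⟨hθ0, (div_pos_iff_of_pos_right hθ0).1 hθ⟩
  have hK : K = deriv (chord X s ρ) 0 ^ 2 := by
    refine tendsto_nhds_unique (tendsto_const_nhds.congr' ?_) (hlim.pow 2)
    filter_upwards [hpos, h] with θ ⟨hθ, hchord⟩ hsq
    rw [div_pow, hsq hchord.ne', mul_div_cancel_right₀ _ (by positivity)]
  filter_upwards [hpos, h] with θ ⟨hθ, hchord⟩ hsq
  rw [← sq_eq_sq₀ hchord.le (by positivity), mul_pow, ← hK, hsq hchord.ne']

namespace IsStrictlyLocallyConvex

variable {I : Set ℝ} {X N : ℝ → Plane} {s : ℝ} {Y v ξ : Plane}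

theorem exists_sub_eq_of_subset_parabola (hX : IsStrictlyLocallyConvex I X N) (hv : v ≠ 0)
    (hvξ : ⟪v, ξ⟫ = 0) (hsub : ∀ u ∈ I, X u ∈ Set.range (parabolaPoint Y v ξ)) (hs : s ∈ I) :
    ∃ w, ⟪w, N s⟫ = 0 ∧ ∀ u ∈ I, ∃ δ : ℝ, X u - X s = δ • w + (δ ^ 2 / 2) • ξ := by
  refine ⟨v + parabolaParam Y v (X s) • ξ, ?_, fun u hu =>
    ⟨parabolaParam Y v (X u) - parabolaParam Y v (X s), ?_⟩⟩
  · have hX' := hX.deriv_eq_of_subset_parabola hv hvξ hsub hs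
    have hinner := hX.inner_normal s hs
    rw [hX', real_inner_smul_left] at hinner
    exact (mul_eq_zero.1 hinner).resolve_left (left_ne_zero_of_smul (hX' ▸ hX.regular s hs))
  · rw [← parabolaPoint_sub, parabolaPoint_parabolaParam hv hvξ (hsub u hu),
      parabolaPoint_parabolaParam hv hvξ (hsub s hs)]

theorem eventually_distJ_of_subset_parabola (hX : IsStrictlyLocallyConvex I X N) (hv : v ≠ 0)
    (hvξ : ⟪v, ξ⟫ = 0) (hsub : ∀ u ∈ I, X u ∈ Set.range (parabolaPoint Y v ξ)) (hs : s ∈ I) :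
    ∀ᶠ h in 𝓝[>] 0, distJ I X N s h = 2 / 3 * h := by
  obtain ⟨ρ, hρ⟩ := hX.exists_isChordParam hs
  obtain ⟨w, hwN, hXsub⟩ := hX.exists_sub_eq_of_subset_parabola hv hvξ hsub hs
  have hneg : Tendsto Neg.neg (𝓝 (0 : ℝ)) (𝓝 0) := continuous_neg.tendsto' 0 0 neg_zero
  have hend := (hρ.eventually_mem hX hs).and hρ.inner_sub
  refine (hρ.eventually_distJ_eq_two_thirds_mul_iff hX hs).2
    (hρ.eventually_chord_eq_of_sq_eq hX hs (K := 8 * ⟪w, deriv X s⟫ ^ 2 / ⟪ξ, N s⟫) ?_)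
  filter_upwards [hend.filter_mono nhdsWithin_le_nhds,
    (hneg.eventually hend).filter_mono nhdsWithin_le_nhds, self_mem_nhdsWithin]
    with θ ⟨hmem, hθ⟩ ⟨hmem', hθ'⟩ (hθ0 : 0 < θ) hchord
  obtain ⟨δ, hδ⟩ := hXsub _ hmem
  obtain ⟨δ', hδ'⟩ := hXsub _ hmem'
  rw [hδ, inner_add_left, real_inner_smul_left, real_inner_smul_left, hwN, mul_zero,
    zero_add] at hθ
  rw [hδ', inner_add_left, real_inner_smul_left, real_inner_smul_left, hwN, mul_zero,
    zero_add, neg_sq, ← hθ] at hθ'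
  have hξN : ⟪ξ, N s⟫ ≠ 0 := right_ne_zero_of_mul (hθ ▸ (pow_pos hθ0 2).ne')
  rw [chord, ← sub_sub_sub_cancel_right _ _ (X s), hδ, hδ'] at hchord ⊢
  have hδδ' : δ' = -δ := by
    refine (sq_eq_sq_iff_eq_or_eq_neg.1 ?_).resolve_left ?_
    · simpa [hξN] using hθ'
    · rintro rfl
      simp at hchord
  rw [hδδ', neg_sq, add_sub_add_right_eq_sub, ← sub_smul, real_inner_smul_left, ← hθ]
  field_simp
  ring

theorem eventually_distJ_of_isOpenPartOfParabola (hX : IsStrictlyLocallyConvex I X N)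
    (h : IsOpenPartOfParabola I X) (hs : s ∈ I) :
    ∀ᶠ h in 𝓝[>] 0, distJ I X N s h = 2 / 3 * h := by
  obtain ⟨C, hC, U, -, hU⟩ := h
  obtain ⟨Y, v, ξ, hv, -, hvξ, rfl⟩ := isParabola_iff_exists_eq_range.1 hC
  exact hX.eventually_distJ_of_subset_parabola hv hvξ
    (fun u hu => (hU.subset (Set.mem_image_of_mem X hu)).1) hs

end IsStrictlyLocallyConvex

/-! ### The affine normal -/

theorem hasDerivAt_areaForm (o : Orientation ℝ Plane (Fin 2)) {f g : ℝ → Plane} {f' g' : Plane}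
    {u : ℝ} (hf : HasDerivAt f f' u) (hg : HasDerivAt g g' u) :
    HasDerivAt (fun t => o.areaForm (f t) (g t)) (o.areaForm (f u) g' + o.areaForm f' (g u)) u :=
  o.areaForm'.hasDerivAt_of_bilinear (fun _ => hf) fun _ => hg

/-- The curve `X` turns counterclockwise with respect to the orientation `o` at every
parameter in `I`. -/
def IsPositivelyCurved (o : Orientation ℝ Plane (Fin 2)) (I : Set ℝ) (X : ℝ → Plane) : Prop :=
  ∀ s ∈ I, 0 < o.areaForm (deriv X s) (deriv (deriv X) s)

namespace IsStrictlyLocallyConvex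

variable {I : Set ℝ} {X N : ℝ → Plane} {s : ℝ} {o : Orientation ℝ Plane (Fin 2)}

theorem differentiableAt_deriv_deriv (hX : IsStrictlyLocallyConvex I X N) (hs : s ∈ I) :
    DifferentiableAt ℝ (deriv (deriv X)) s :=
  ((hX.contDiffAt_deriv hs).derivWithin (m := 1) (by norm_num)).differentiableAt one_ne_zero

theorem differentiableAt_areaForm (hX : IsStrictlyLocallyConvex I X N) (hs : s ∈ I) :
    DifferentiableAt ℝ (fun u => o.areaForm (deriv X u) (deriv (deriv X) u)) s :=
  (hasDerivAt_areaForm o (hX.hasDerivAt_deriv hs)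
    (hX.differentiableAt_deriv_deriv hs).hasDerivAt).differentiableAt

theorem areaForm_mul_areaForm_normal (hX : IsStrictlyLocallyConvex I X N) (hs : s ∈ I) (v : Plane) :
    o.areaForm (deriv X s) v * o.areaForm (deriv X s) (N s) = ‖deriv X s‖ ^ 2 * ⟪v, N s⟫ := by
  rw [← o.inner_mul_inner_add_areaForm_mul_areaForm, hX.inner_normal s hs, mul_zero, zero_add]

theorem areaForm_deriv_ne_zero (hX : IsStrictlyLocallyConvex I X N) (hs : s ∈ I) :
    o.areaForm (deriv X s) (deriv (deriv X) s) ≠ 0 := by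
  refine left_ne_zero_of_mul (b := o.areaForm (deriv X s) (N s)) ?_
  rw [hX.areaForm_mul_areaForm_normal hs]
  exact mul_ne_zero (pow_ne_zero 2 (norm_ne_zero_iff.2 (hX.regular s hs)))
    (hX.inner_deriv_deriv_normal_pos hs).ne'

theorem exists_isPositivelyCurved (hX : IsStrictlyLocallyConvex I X N) :
    ∃ o, IsPositivelyCurved o I X := by
  obtain ⟨s₀, hs₀⟩ := hX.nonempty
  obtain ⟨o, ho⟩ : ∃ o : Orientation ℝ Plane (Fin 2),
      0 < o.areaForm (deriv X s₀) (deriv (deriv X) s₀) := by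
    set o := (EuclideanSpace.basisFun (Fin 2) ℝ).toBasis.orientation
    rcases (hX.areaForm_deriv_ne_zero (o := o) hs₀).lt_or_gt with hneg | hpos
    · exact ⟨-o, by simpa [o.areaForm_neg_orientation] using hneg⟩
    · exact ⟨o, hpos⟩
  refine ⟨o, fun s hs => ?_⟩
  by_contra! hneg
  obtain ⟨u, hu, hu0⟩ := hX.ordConnected.isPreconnected.intermediate_value hs hs₀
    (fun u hu => (hX.differentiableAt_areaForm (o := o) hu).continuousAt.continuousWithinAt)
    ⟨hneg, ho.le⟩
  exact hX.areaForm_deriv_ne_zero hu hu0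

theorem areaForm_deriv_eq (hX : IsStrictlyLocallyConvex I X N) (ho : IsPositivelyCurved o I X)
    (hs : s ∈ I) (v : Plane) : o.areaForm (deriv X s) v = ‖deriv X s‖ * ⟪v, N s⟫ := by
  have hnorm : 0 < ‖deriv X s‖ := norm_pos_iff.2 (hX.regular s hs)
  have hN : o.areaForm (deriv X s) (N s) = ‖deriv X s‖ := by
    have hpos : 0 < o.areaForm (deriv X s) (N s) := by
      refine (pos_iff_pos_of_mul_pos ?_).1 (ho s hs)
      rw [hX.areaForm_mul_areaForm_normal hs]
      exact mul_pos (pow_pos hnorm 2) (hX.inner_deriv_deriv_normal_pos hs)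
    rw [← abs_of_pos hpos, o.abs_areaForm_of_orthogonal (hX.inner_normal s hs),
      hX.norm_normal s hs, mul_one]
  have h := hX.areaForm_mul_areaForm_normal (o := o) hs v
  rw [hN] at h
  refine mul_right_cancel₀ hnorm.ne' (h.trans ?_)
  ring

end IsStrictlyLocallyConvex

/-- The speed of `X` with respect to affine arc length, for the area form of `o`. -/
def affineSpeed (o : Orientation ℝ Plane (Fin 2)) (X : ℝ → Plane) (u : ℝ) : ℝ :=
  o.areaForm (deriv X u) (deriv (deriv X) u) ^ (1 / 3 : ℝ)

/-- The derivative of `X` with respect to affine arc length. -/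
def affineTangent (o : Orientation ℝ Plane (Fin 2)) (X : ℝ → Plane) (u : ℝ) : Plane :=
  (affineSpeed o X u)⁻¹ • deriv X u

/-- The affine normal: the second derivative of `X` with respect to affine arc length. It is
constant exactly along arcs of parabolas. -/
def affineNormal (o : Orientation ℝ Plane (Fin 2)) (X : ℝ → Plane) (u : ℝ) : Plane :=
  (affineSpeed o X u)⁻¹ • deriv (affineTangent o X) u

section AffineNormal

variable {I : Set ℝ} {X N : ℝ → Plane} {s : ℝ} {o : Orientation ℝ Plane (Fin 2)}

theorem affineSpeed_pos (ho : IsPositivelyCurved o I X) (hs : s ∈ I) : 0 < affineSpeed o X s :=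
  Real.rpow_pos_of_pos (ho s hs) _

theorem affineSpeed_pow_three (ho : IsPositivelyCurved o I X) (hs : s ∈ I) :
    affineSpeed o X s ^ 3 = o.areaForm (deriv X s) (deriv (deriv X) s) := by
  rw [affineSpeed, ← Real.rpow_natCast, ← Real.rpow_mul (ho s hs).le]
  norm_num

theorem affineSpeed_smul_affineTangent (ho : IsPositivelyCurved o I X) (hs : s ∈ I) :
    affineSpeed o X s • affineTangent o X s = deriv X s :=
  smul_inv_smul₀ (affineSpeed_pos ho hs).ne' _

theorem IsStrictlyLocallyConvex.differentiableAt_affineSpeed (hX : IsStrictlyLocallyConvex I X N)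
    (ho : IsPositivelyCurved o I X) (hs : s ∈ I) : DifferentiableAt ℝ (affineSpeed o X) s :=
  (hX.differentiableAt_areaForm hs).rpow_const (Or.inl (ho s hs).ne')

theorem IsStrictlyLocallyConvex.hasDerivAt_affineTangent (hX : IsStrictlyLocallyConvex I X N)
    (ho : IsPositivelyCurved o I X) (hs : s ∈ I) :
    HasDerivAt (affineTangent o X) (affineSpeed o X s • affineNormal o X s) s := by
  rw [affineNormal, smul_inv_smul₀ (affineSpeed_pos ho hs).ne', hasDerivAt_deriv_iff]
  exact ((hX.differentiableAt_affineSpeed ho hs).inv (affineSpeed_pos ho hs).ne').smul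
    (hX.hasDerivAt_deriv hs).differentiableAt

theorem areaForm_affineTangent_affineNormal (hX : IsStrictlyLocallyConvex I X N)
    (ho : IsPositivelyCurved o I X) (hs : s ∈ I) :
    o.areaForm (affineTangent o X s) (affineNormal o X s) = 1 := by
  have hv := affineSpeed_pos ho hs
  have hT := ((hX.differentiableAt_affineSpeed ho hs).hasDerivAt.fun_inv hv.ne').smul
    (hX.hasDerivAt_deriv hs)
  have h := congrArg (o.areaForm (deriv X s)) (hT.unique (hX.hasDerivAt_affineTangent ho hs))
  simp only [map_add, map_smul, o.areaForm_apply_self, smul_eq_mul, mul_zero, add_zero,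
    ← affineSpeed_pow_three ho hs] at h
  rw [affineTangent, map_smul, LinearMap.smul_apply, smul_eq_mul]
  field_simp at h ⊢
  exact h.symm

end AffineNormal

/-- `φ` parametrizes an arc of `X` by the coordinate `⟪X, e⟫`, which ranges over the open interval
`J`. -/
structure IsGraphParam (I : Set ℝ) (X : ℝ → Plane) (e : Plane) (J : Set ℝ) (φ : ℝ → ℝ) :
    Prop where
  isOpen : IsOpen J
  ordConnected : J.OrdConnected
  mem : ∀ y ∈ J, φ y ∈ I
  inner_apply : ∀ y ∈ J, ⟪X (φ y), e⟫ = y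
  eventually_left_inv : ∀ y ∈ J, ∀ᶠ u in 𝓝 (φ y), φ ⟪X u, e⟫ = u
  inner_deriv_pos : ∀ y ∈ J, 0 < ⟪deriv X (φ y), e⟫
  hasDerivAt : ∀ y ∈ J, HasDerivAt φ ⟪deriv X (φ y), e⟫⁻¹ y

/-- The coordinate of `X` transverse to `e`, as a function of the coordinate along `e` on an arc
that is parametrized by `φ` in terms of the latter. -/
def graphHeight (o : Orientation ℝ Plane (Fin 2)) (X : ℝ → Plane) (e : Plane) (φ : ℝ → ℝ)
    (t : ℝ) : ℝ :=
  o.areaForm e (X (φ t)) / ‖e‖ ^ 2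

/-- The derivative of `graphHeight`. -/
def graphSlope (o : Orientation ℝ Plane (Fin 2)) (X : ℝ → Plane) (e : Plane) (φ : ℝ → ℝ)
    (t : ℝ) : ℝ :=
  o.areaForm e (deriv X (φ t)) / (‖e‖ ^ 2 * ⟪deriv X (φ t), e⟫)

/-- Arbitrarily close to `X s`, the curve `X` has chords that are parallel to its tangent at `X s`
and have the length such a chord has in a parabola. -/
def HasParabolicChords (o : Orientation ℝ Plane (Fin 2)) (X : ℝ → Plane) (s : ℝ) : Prop :=
  ∃ᶠ z in 𝓝[<] s ×ˢ 𝓝[>] s, ∃ l : ℝ, X z.2 - X z.1 = l • deriv X s ∧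
    l ^ 2 * o.areaForm (deriv X s) (deriv (deriv X) s) =
      8 * o.areaForm (deriv X s) (X z.1 - X s)

section GraphParam

variable {I : Set ℝ} {X N : ℝ → Plane} {s : ℝ} {e : Plane} {J : Set ℝ} {φ : ℝ → ℝ}
  {o : Orientation ℝ Plane (Fin 2)}

namespace IsStrictlyLocallyConvex

theorem hasDerivAt_inner (hX : IsStrictlyLocallyConvex I X N) (hs : s ∈ I) (e : Plane) :
    HasDerivAt (fun u => ⟪X u, e⟫) ⟪deriv X s, e⟫ s := by
  simpa using (hX.hasDerivAt hs).inner ℝ (hasDerivAt_const s e)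

theorem exists_isGraphParam (hX : IsStrictlyLocallyConvex I X N) (hs : s ∈ I)
    (he : 0 < ⟪deriv X s, e⟫) :
    ∃ J φ, IsGraphParam I X e J φ ∧ ⟪X s, e⟫ ∈ J ∧ φ ⟪X s, e⟫ = s := by
  have hderiv : ∀ u ∈ I, deriv (fun u => ⟪X u, e⟫) u = ⟪deriv X u, e⟫ := fun u hu =>
    (hX.hasDerivAt_inner hu e).deriv
  obtain ⟨φ, hφ, hφs, hinv⟩ := exists_contDiffAt_localInverse
    ((hX.contDiffAt hs).inner ℝ contDiffAt_const) three_ne_zero ((hderiv s hs).trans_ne he.ne')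
  have hpos : ∀ᶠ u in 𝓝 s, 0 < ⟪deriv X u, e⟫ :=
    ((hX.hasDerivAt_deriv hs).continuousAt.inner continuousAt_const).eventually_const_lt he
  have hnear : ∀ᶠ y in 𝓝 ⟪X s, e⟫, φ y ∈ I ∧ 0 < ⟪deriv X (φ y), e⟫ :=
    hφ.continuousAt.eventually (by rw [hφs]; exact (hX.isOpen.eventually_mem hs).and hpos)
  obtain ⟨δ, hδ, H⟩ := Metric.eventually_nhds_iff_ball.1 (hinv.and hnear)
  refine ⟨_, φ, ⟨Metric.isOpen_ball, (convex_ball _ _).ordConnected, fun y hy => (H y hy).2.1,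
    fun y hy => (H y hy).1.1, fun y hy => (H y hy).1.2.1, fun y hy => (H y hy).2.2,
    fun y hy => ?_⟩, Metric.mem_ball_self hδ, hφs⟩
  rw [← hderiv _ (H y hy).2.1]
  exact (H y hy).1.2.2

end IsStrictlyLocallyConvex

namespace IsGraphParam

theorem hasDerivAt_graphHeight (hφ : IsGraphParam I X e J φ) (hX : IsStrictlyLocallyConvex I X N)
    {y : ℝ} (hy : y ∈ J) : HasDerivAt (graphHeight o X e φ) (graphSlope o X e φ y) y := by
  have hXφ := (hX.hasDerivAt (hφ.mem y hy)).scomp y (hφ.hasDerivAt y hy)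
  refine ((hasDerivAt_areaForm o (hasDerivAt_const y e) hXφ).div_const _).congr_deriv ?_
  simp only [graphSlope, map_zero, LinearMap.zero_apply, add_zero, map_smul, smul_eq_mul]
  ring

theorem ne_zero (hφ : IsGraphParam I X e J φ) {y : ℝ} (hy : y ∈ J) : e ≠ 0 := by
  rintro rfl
  simpa using hφ.inner_deriv_pos y hy

theorem hasDerivAt_graphSlope (hφ : IsGraphParam I X e J φ) (hX : IsStrictlyLocallyConvex I X N)
    (ho : IsPositivelyCurved o I X) {y : ℝ} (hy : y ∈ J) :
    HasDerivAt (graphSlope o X e φ) (⟪affineTangent o X (φ y), e⟫ ^ 3)⁻¹ y := by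
  have hs := hφ.mem y hy
  have hpos := hφ.inner_deriv_pos y hy
  have he : 0 < ‖e‖ := norm_pos_iff.2 (hφ.ne_zero hy)
  have hX'φ := (hX.hasDerivAt_deriv hs).scomp y (hφ.hasDerivAt y hy)
  have hnum := hasDerivAt_areaForm o (hasDerivAt_const y e) hX'φ
  have hden := (hX'φ.inner ℝ (hasDerivAt_const y e)).const_mul (‖e‖ ^ 2)
  refine (hnum.div hden (by simp only [Function.comp]; positivity)).congr_deriv ?_
  have harea := o.inner_mul_areaForm_sub e (deriv X (φ y)) (deriv (deriv X) (φ y))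
  rw [← affineSpeed_pow_three ho hs, real_inner_comm, real_inner_comm _ e] at harea
  have hv := (affineSpeed_pos ho hs).ne'
  simp only [Function.comp, map_zero, LinearMap.zero_apply, add_zero, map_smul, smul_eq_mul,
    inner_zero_right, zero_add, real_inner_smul_left, affineTangent]
  field_simp
  linear_combination harea

theorem inner_affineTangent_pos (hφ : IsGraphParam I X e J φ) (ho : IsPositivelyCurved o I X)
    {y : ℝ} (hy : y ∈ J) : 0 < ⟪affineTangent o X (φ y), e⟫ := by
  rw [affineTangent, real_inner_smul_left]
  exact mul_pos (inv_pos.2 (affineSpeed_pos ho (hφ.mem y hy))) (hφ.inner_deriv_pos y hy)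

theorem hasDerivAt_inner_affineTangent (hφ : IsGraphParam I X e J φ)
    (hX : IsStrictlyLocallyConvex I X N) (ho : IsPositivelyCurved o I X) {y : ℝ} (hy : y ∈ J) :
    HasDerivAt (fun t => ⟪affineTangent o X (φ t), e⟫)
      (⟪affineNormal o X (φ y), e⟫ / ⟪affineTangent o X (φ y), e⟫) y := by
  have hs := hφ.mem y hy
  have hpos := hφ.inner_deriv_pos y hy
  have hT := (hX.hasDerivAt_affineTangent ho hs).scomp y (hφ.hasDerivAt y hy)
  refine (hT.inner ℝ (hasDerivAt_const y e)).congr_deriv ?_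
  have hv := affineSpeed_pos ho hs
  simp only [inner_zero_right, zero_add, real_inner_smul_left]
  rw [affineTangent, real_inner_smul_left]
  field_simp

theorem tendsto_prodMap (hφ : IsGraphParam I X e J φ) (hX : IsStrictlyLocallyConvex I X N)
    {p : ℝ} (hp : p ∈ J) : Tendsto (Prod.map (fun u => ⟪X u, e⟫) fun u => ⟪X u, e⟫)
      (𝓝[<] φ p ×ˢ 𝓝[>] φ p) (𝓝[<] p ×ˢ 𝓝[>] p) := by
  have hderiv := hX.hasDerivAt_inner (hφ.mem p hp) e
  have hpos := hφ.inner_deriv_pos p hp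
  simpa only [hφ.inner_apply p hp] using
    (tendsto_nhdsLT_of_hasDerivAt_of_pos hderiv hpos).prodMap
      (tendsto_nhdsGT_of_hasDerivAt_of_pos hderiv hpos)

end IsGraphParam

end GraphParam

section ConstantAffineNormal

variable {I : Set ℝ} {X N : ℝ → Plane} {s : ℝ} {e : Plane} {J : Set ℝ} {φ : ℝ → ℝ}
  {o : Orientation ℝ Plane (Fin 2)}

namespace IsGraphParam

theorem tangentGap_inner (hφ : IsGraphParam I X e J φ) {p u : ℝ} (hp : p ∈ J)
    (hu : φ ⟪X u, e⟫ = u) :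
    tangentGap (graphHeight o X e φ) (graphSlope o X e φ) p ⟪X u, e⟫ =
      o.areaForm (deriv X (φ p)) (X u - X (φ p)) / ⟪deriv X (φ p), e⟫ := by
  have hpos := hφ.inner_deriv_pos p hp
  have he : 0 < ‖e‖ := norm_pos_iff.2 (hφ.ne_zero hp)
  have harea := o.inner_mul_areaForm_sub e (deriv X (φ p)) (X u - X (φ p))
  rw [real_inner_comm, real_inner_comm _ e, inner_sub_left, hφ.inner_apply p hp, map_sub,
    map_sub] at harea
  simp only [tangentGap, graphHeight, graphSlope, hu, map_sub]
  field_simp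
  linear_combination harea

theorem graphHasParabolicChords (hφ : IsGraphParam I X e J φ) (hX : IsStrictlyLocallyConvex I X N)
    (ho : IsPositivelyCurved o I X) {p : ℝ} (hp : p ∈ J) (hchord : HasParabolicChords o X (φ p)) :
    GraphHasParabolicChords (graphHeight o X e φ) (graphSlope o X e φ)
      (fun t => ⟪affineTangent o X (φ t), e⟫) p := by
  have hs := hφ.mem p hp
  have hpos := hφ.inner_deriv_pos p hp
  have hinv := hφ.eventually_left_inv p hp
  refine (hφ.tendsto_prodMap hX hp).frequently ((hchord.and_eventually <|
    (hinv.filter_mono nhdsWithin_le_nhds).prod_mk (hinv.filter_mono nhdsWithin_le_nhds)).mono ?_)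
  rintro ⟨a, b⟩ ⟨⟨l, hl, hlen⟩, ha, hb⟩
  have hXb : X b - X (φ p) = l • deriv X (φ p) + (X a - X (φ p)) := by rw [← hl]; abel
  have hwidth : ⟪X b, e⟫ - ⟪X a, e⟫ = l * ⟪deriv X (φ p), e⟫ := by
    rw [← inner_sub_left, hl, real_inner_smul_left]
  simp only [Prod.map_apply, hφ.tangentGap_inner hp ha, hφ.tangentGap_inner hp hb, hXb, hwidth,
    map_add, map_smul, o.areaForm_apply_self, smul_zero, zero_add, true_and, affineTangent,
    real_inner_smul_left]
  rw [← affineSpeed_pow_three ho hs] at hlen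
  have hv := affineSpeed_pos ho hs
  field_simp
  exact hlen

theorem inner_affineNormal_eq (hφ : IsGraphParam I X e J φ) (hX : IsStrictlyLocallyConvex I X N)
    (ho : IsPositivelyCurved o I X) (hchord : ∀ s ∈ I, HasParabolicChords o X s) {t u : ℝ}
    (ht : t ∈ J) (hu : u ∈ J) :
    ⟪affineNormal o X (φ t), e⟫ = ⟪affineNormal o X (φ u), e⟫ := by
  have hderiv : ∀ y ∈ J, deriv (fun y => ⟪affineTangent o X (φ y), e⟫ ^ 2) y =
      2 * ⟪affineNormal o X (φ y), e⟫ := by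
    intro y hy
    rw [((hφ.hasDerivAt_inner_affineTangent hX ho hy).fun_pow 2).deriv]
    have := (hφ.inner_affineTangent_pos ho hy).ne'
    field_simp
    norm_num
    ring
  have h := deriv_sq_eq_of_graphHasParabolicChords hφ.isOpen hφ.ordConnected
    (fun y hy => hφ.hasDerivAt_graphHeight (o := o) hX hy)
    (fun y hy => hφ.hasDerivAt_graphSlope hX ho hy) (fun y hy => hφ.inner_affineTangent_pos ho hy)
    (fun y hy => (hφ.hasDerivAt_inner_affineTangent hX ho hy).differentiableAt)
    (fun y hy => hφ.graphHasParabolicChords hX ho hy (hchord _ (hφ.mem y hy))) ht hu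
  rw [hderiv t ht, hderiv u hu] at h
  exact mul_left_cancel₀ two_ne_zero h

end IsGraphParam

namespace IsStrictlyLocallyConvex

theorem eventually_inner_affineNormal_eq (hX : IsStrictlyLocallyConvex I X N)
    (ho : IsPositivelyCurved o I X) (hchord : ∀ s ∈ I, HasParabolicChords o X s) (hs : s ∈ I)
    (he : 0 < ⟪deriv X s, e⟫) :
    ∀ᶠ u in 𝓝 s, ⟪affineNormal o X s, e⟫ = ⟪affineNormal o X u, e⟫ := by
  obtain ⟨J, φ, hφ, hsJ, hφs⟩ := hX.exists_isGraphParam hs he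
  filter_upwards [(hX.hasDerivAt_inner hs e).continuousAt.eventually_mem (hφ.isOpen.mem_nhds hsJ),
    hφs ▸ hφ.eventually_left_inv _ hsJ] with u huJ hu
  simpa only [hφs, hu] using hφ.inner_affineNormal_eq hX ho hchord hsJ huJ

theorem eventually_affineNormal_eq (hX : IsStrictlyLocallyConvex I X N)
    (ho : IsPositivelyCurved o I X) (hchord : ∀ s ∈ I, HasParabolicChords o X s) (hs : s ∈ I) :
    ∀ᶠ u in 𝓝 s, affineNormal o X s = affineNormal o X u := by
  have hpos : 0 < ⟪deriv X s, deriv X s⟫ := real_inner_self_pos.2 (hX.regular s hs)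
  filter_upwards [hX.eventually_inner_affineNormal_eq ho hchord hs hpos,
    hX.eventually_inner_affineNormal_eq (e := deriv X s + N s) ho hchord hs
      (by rwa [inner_add_right, hX.inner_normal s hs, add_zero])] with u htangent hsum
  rw [inner_add_right, inner_add_right, htangent, add_right_inj] at hsum
  exact eq_of_inner_eq_of_orthogonal (hX.regular s hs) (hX.normal_ne_zero hs)
    (hX.inner_normal s hs) htangent hsum

theorem affineNormal_eq (hX : IsStrictlyLocallyConvex I X N) (ho : IsPositivelyCurved o I X)
    (hchord : ∀ s ∈ I, HasParabolicChords o X s) {u : ℝ} (hs : s ∈ I) (hu : u ∈ I) :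
    affineNormal o X s = affineNormal o X u :=
  hX.ordConnected.isPreconnected.induction₂ (fun s u => affineNormal o X s = affineNormal o X u)
    (fun _ hx => (hX.eventually_affineNormal_eq ho hchord hx).filter_mono nhdsWithin_le_nhds)
    (fun _ _ _ _ _ _ => Eq.trans) (fun _ _ _ _ => Eq.symm) hs hu

end IsStrictlyLocallyConvex

end ConstantAffineNormal

section ParabolicArc

variable {I : Set ℝ} {X N : ℝ → Plane} {s : ℝ} {ρ : ℝ → ℝ} {ξ : Plane}
  {o : Orientation ℝ Plane (Fin 2)}

namespace IsChordParam

theorem tendsto_prod (hρ : IsChordParam X N s ρ) :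
    Tendsto (fun θ => (ρ (-θ), ρ θ)) (𝓝[>] 0) (𝓝[<] s ×ˢ 𝓝[>] s) := by
  have hderiv := (hρ.contDiffAt.differentiableAt one_ne_zero).hasDerivAt
  have hneg : Tendsto Neg.neg (𝓝[>] (0 : ℝ)) (𝓝[<] 0) := by
    simpa only [neg_zero] using tendsto_neg_nhdsGT (a := (0 : ℝ))
  simpa only [hρ.map_zero, Function.comp_apply] using
    ((tendsto_nhdsLT_of_hasDerivAt_of_pos hderiv hρ.deriv_pos).comp hneg).prodMk
      (tendsto_nhdsGT_of_hasDerivAt_of_pos hderiv hρ.deriv_pos)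

theorem hasParabolicChords (hρ : IsChordParam X N s ρ) (hX : IsStrictlyLocallyConvex I X N)
    (ho : IsPositivelyCurved o I X) (hs : s ∈ I)
    (hchord : ∀ᶠ θ in 𝓝[>] 0, chord X s ρ θ = deriv (chord X s ρ) 0 * θ) :
    HasParabolicChords o X s := by
  have hneg : Tendsto Neg.neg (𝓝 (0 : ℝ)) (𝓝 0) := continuous_neg.tendsto' 0 0 neg_zero
  refine hρ.tendsto_prod.frequently (Eventually.frequently ?_)
  filter_upwards [hchord, hρ.inner_sub.filter_mono nhdsWithin_le_nhds,
    (hneg.eventually hρ.inner_sub).filter_mono nhdsWithin_le_nhds] with θ hθ hright hleft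
  refine ⟨2 * deriv ρ 0 * θ, eq_of_inner_eq_of_orthogonal (hX.regular s hs)
    (hX.normal_ne_zero hs) (hX.inner_normal s hs) ?_ ?_, ?_⟩
  · rw [← chord, hθ, hρ.deriv_chord_zero hX hs, real_inner_smul_left, real_inner_self_eq_norm_sq]
    ring
  · rw [← sub_sub_sub_cancel_right _ _ (X s), inner_sub_left, hright, hleft, neg_sq, sub_self,
      real_inner_smul_left, hX.inner_normal s hs, mul_zero]
  · rw [hX.areaForm_deriv_eq ho hs, hX.areaForm_deriv_eq ho hs, hleft]
    linear_combination 4 * θ ^ 2 * ‖deriv X s‖ * hρ.mul_deriv_sq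

end IsChordParam

namespace IsStrictlyLocallyConvex

theorem eq_of_forall_hasDerivAt_zero (hX : IsStrictlyLocallyConvex I X N) {Z : ℝ → Plane}
    (hZ : ∀ u ∈ I, HasDerivAt Z 0 u) {t u : ℝ} (ht : t ∈ I) (hu : u ∈ I) : Z t = Z u :=
  hX.isOpen.is_const_of_deriv_eq_zero hX.ordConnected.isPreconnected
    (fun x hx => (hZ x hx).differentiableAt.differentiableWithinAt) (fun x hx => (hZ x hx).deriv)
    ht hu

theorem exists_affineTangent_eq (hX : IsStrictlyLocallyConvex I X N)
    (ho : IsPositivelyCurved o I X) (hξ : ξ ≠ 0) (hconst : ∀ u ∈ I, affineNormal o X u = ξ) :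
    ∃ (v : Plane) (τ : ℝ → ℝ), ⟪v, ξ⟫ = 0 ∧ ∀ u ∈ I, affineTangent o X u = v + τ u • ξ ∧
      HasDerivAt τ (affineSpeed o X u) u := by
  have hξ' : ‖ξ‖ ^ 2 ≠ 0 := pow_ne_zero 2 (norm_ne_zero_iff.2 hξ)
  obtain ⟨s, hs⟩ := hX.nonempty
  have hT : ∀ u ∈ I, HasDerivAt (affineTangent o X) (affineSpeed o X u • ξ) u := fun u hu =>
    hconst u hu ▸ hX.hasDerivAt_affineTangent ho hu
  set τ : ℝ → ℝ := fun u => ⟪affineTangent o X u, ξ⟫ / ‖ξ‖ ^ 2 with hτ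
  have hτ' : ∀ u ∈ I, HasDerivAt τ (affineSpeed o X u) u := fun u hu => by
    refine (((hT u hu).inner ℝ (hasDerivAt_const u ξ)).div_const _).congr_deriv ?_
    rw [inner_zero_right, zero_add, real_inner_smul_left, real_inner_self_eq_norm_sq,
      mul_div_cancel_right₀ _ hξ']
  refine ⟨affineTangent o X s - τ s • ξ, τ, ?_, fun u hu => ⟨?_, hτ' u hu⟩⟩
  · rw [inner_sub_left, real_inner_smul_left, real_inner_self_eq_norm_sq, hτ,
      div_mul_cancel₀ _ hξ', sub_self]
  · rw [← sub_eq_iff_eq_add]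
    exact hX.eq_of_forall_hasDerivAt_zero (Z := fun u => affineTangent o X u - τ u • ξ)
      (fun x hx => ((hT x hx).sub ((hτ' x hx).smul_const ξ)).congr_deriv (sub_self _)) hu hs

theorem isOpenPartOfParabola_of_affineNormal_eq (hX : IsStrictlyLocallyConvex I X N)
    (ho : IsPositivelyCurved o I X) (hconst : ∀ u ∈ I, affineNormal o X u = ξ) :
    IsOpenPartOfParabola I X := by
  obtain ⟨s, hs⟩ := hX.nonempty
  have harea : o.areaForm (affineTangent o X s) ξ = 1 :=
    hconst s hs ▸ areaForm_affineTangent_affineNormal hX ho hs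
  have hξ : ξ ≠ 0 := by
    rintro rfl
    simp at harea
  obtain ⟨v, τ, hvξ, hτ⟩ := hX.exists_affineTangent_eq ho hξ hconst
  have hv : v ≠ 0 := by
    rintro rfl
    simp [(hτ s hs).1] at harea
  have hX' : ∀ u ∈ I, HasDerivAt (fun u => X u - parabolaPoint 0 v ξ (τ u)) 0 u := fun u hu => by
    refine ((hX.hasDerivAt hu).sub (hasDerivAt_parabolaPoint_comp (hτ u hu).2)).congr_deriv ?_
    rw [← (hτ u hu).1, affineSpeed_smul_affineTangent ho hu, sub_self]
  refine hX.isOpenPartOfParabola_of_subset (Y := X s - parabolaPoint 0 v ξ (τ s)) hv hξ hvξ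
    fun u hu => ⟨τ u, ?_⟩
  rw [hX.eq_of_forall_hasDerivAt_zero hX' hs hu]
  simp only [parabolaPoint]
  module

theorem isOpenPartOfParabola_of_eventually_distJ (hX : IsStrictlyLocallyConvex I X N)
    (h : ∀ s ∈ I, ∀ᶠ h in 𝓝[>] 0, distJ I X N s h = 2 / 3 * h) : IsOpenPartOfParabola I X := by
  obtain ⟨o, ho⟩ := hX.exists_isPositivelyCurved
  have hchords : ∀ s ∈ I, HasParabolicChords o X s := fun s hs => by
    obtain ⟨ρ, hρ⟩ := hX.exists_isChordParam hs
    exact hρ.hasParabolicChords hX ho hs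
      ((hρ.eventually_distJ_eq_two_thirds_mul_iff hX hs).1 (h s hs))
  obtain ⟨s, hs⟩ := hX.nonempty
  exact hX.isOpenPartOfParabola_of_affineNormal_eq ho fun u hu =>
    hX.affineNormal_eq ho hchords hu hs

end IsStrictlyLocallyConvex

end ParabolicArc

end PlaneCurve

end

theorem theorem5 (I : Set ℝ) (X N : ℝ → PlaneCurve.Plane)
    (hX : PlaneCurve.IsStrictlyLocallyConvex I X N) :
    List.TFAE
      [∃ lam mu : ℝ → ℝ, ∀ s ∈ I, ∀ᶠ h in 𝓝[>] (0 : ℝ),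
          PlaneCurve.distJ I X N s h = lam s * h ^ mu s,
        ∀ s ∈ I, ∀ᶠ h in 𝓝[>] (0 : ℝ), PlaneCurve.distJ I X N s h = 2 / 3 * h,
        PlaneCurve.IsOpenPartOfParabola I X] := by
  tfae_have 1 → 2 := fun ⟨_, _, h⟩ s hs => hX.eventually_distJ_of_eq_mul_rpow hs (h s hs)
  tfae_have 2 → 1 := fun h =>
    ⟨fun _ => 2 / 3, fun _ => 1, fun s hs => by simpa only [Real.rpow_one] using h s hs⟩
  tfae_have 2 → 3 := hX.isOpenPartOfParabola_of_eventually_distJ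
  tfae_have 3 → 2 := fun h _ hs => hX.eventually_distJ_of_isOpenPartOfParabola h hs
  tfae_finish
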